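/- Throughout, digraphs have no loops and no parallel or antiparallel arcs. A tournament is a digraph $D$ in which, for any two distinct vertices $u,v$, exactly one of $uv$, $vu$ is an arc. A directed cycle is a finite one, on at least three pairwise distinct vertices. If $C$ is a directed cycle of $D$, then $D$ reversed along $C$ is the digraph on the same vertex set with arc set $(A(D)\setminus A(C))\cup\{vu : uv\in A(C)\}$. Transfinite sequences $\mathcal C=\langle C_\xi : \xi<\alpha\rangle$ ($\alpha$ an ordinal) that are reversal sequences of $D$, written $\mathcal C\in\mathrm{rs}(D)$, and the digraph $D_{\mathcal C}$ ($D$ reversed along $\mathcal C$) are defined simultaneously by recursion on the length $\alpha$: 1. the empty sequence is in $\mathrm{rs}(D)$, and $D_\emptyset=D$; 2. if $\mathcal C\in\mathrm{rs}(D)$ and $C^*$ is a directed cycle of $D_{\mathcal C}$, then the extended sequence $\mathcal C^\smallfrown\langle C^*\rangle$ is in $\mathrm{rs}(D)$, and $D_{\mathcal C^\smallfrown\langle C^*\rangle}$ is $D_{\mathcal C}$ reversed along $C^*$; 3. if $\lambda$ is a limit ordinal, $\mathcal C=\langle C_\xi:\xi<\lambda\rangle$, every proper initial segment $\mathcal C\restriction\xi$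 ($\xi<\lambda$) is in $\mathrm{rs}(D)$, and $\mathcal C$ is locally finite, i.e. each arc lies in $C_\xi$ for only finitely many $\xi<\lambda$, then $\mathcal C\in\mathrm{rs}(D)$, and $uv$ is an arc of $D_{\mathcal C}$ iff for some $\nu<\lambda$ it is an arc of $D_{\mathcal C\restriction\xi}$ for all $\nu<\xi<\lambda$. A set $S$ of vertices is strong if for all $u,v\in S$ there is a directed path from $u$ to $v$ inside $S$; the strong components of a digraph are its maximal strong sets of vertices. **Theorem.** For every tournament $D$, of arbitrary (finite or infinite) cardinality, there is a locally finite $\mathcal C\in\mathrm{rs}(D)$ such that all strong components of $D_{\mathcal C}$ are finite. -/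

import Mathlib

universe u

namespace Digraph

variable {V : Type u}

/-- A tournament: there are no loops, and for any two distinct vertices `a`, `b` exactly one of
the pairs `(a, b)`, `(b, a)` is an arc. -/
def IsTournament (D : Digraph V) : Prop :=
  (∀ a, ¬ D.Adj a a) ∧ ∀ a b, a ≠ b → (D.Adj a b ↔ ¬ D.Adj b a)

/-- `C` is the arc set of a directed cycle of `D`: there are `n ≥ 3` pairwise distinct vertices
`x 0, …, x (n - 1)`, indexed cyclically, such that every `(x i, x (i + 1))` is an arc of `D`,
and `C` consists exactly of these arcs. -/
def IsDirectedCycle (D : Digraph V) (C : Set (V × V)) : Prop :=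
  ∃ n : ℕ, 3 ≤ n ∧ ∃ x : ZMod n → V, Function.Injective x ∧
    (∀ i, D.Adj (x i) (x (i + 1))) ∧ C = Set.range fun i => (x i, x (i + 1))

/-- `D` with the arcs in `C` reversed: the arc set is `(A(D) \ C) ∪ {ba : ab ∈ C}`. -/
def reverse (D : Digraph V) (C : Set (V × V)) : Digraph V where
  Adj a b := (D.Adj a b ∧ (a, b) ∉ C) ∨ (b, a) ∈ C

/-- The limit of the digraphs `G ξ`, `ξ < l`: `ab` is an arc of the limit iff it is an arc of
`G ξ` for all sufficiently large `ξ < l`. -/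
def limitBelow (G : Ordinal.{u} → Digraph V) (l : Ordinal.{u}) : Digraph V where
  Adj a b := ∃ m < l, ∀ ξ, m < ξ → ξ < l → (G ξ).Adj a b

/-- The sequence `⟨C ξ : ξ < l⟩` is locally finite: each arc lies in `C ξ` for only finitely many
`ξ < l`. -/
def LocallyFiniteBelow (C : Ordinal.{u} → Set (V × V)) (l : Ordinal.{u}) : Prop :=
  ∀ a b : V, {ξ | ξ < l ∧ (a, b) ∈ C ξ}.Finite

/-- `ReversesTo D C α G` says that the transfinite sequence `⟨C ξ : ξ < α⟩` is a reversal
sequence of `D`, and that `D` reversed along this sequence is `G`. Both are defined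
simultaneously by recursion; only the values `C ξ` with `ξ < α` matter. -/
inductive ReversesTo (D : Digraph V) (C : Ordinal.{u} → Set (V × V)) :
    Ordinal.{u} → Digraph V → Prop
  | empty : ReversesTo D C 0 D
  | snoc (α : Ordinal.{u}) (G : Digraph V) :
      ReversesTo D C α G → G.IsDirectedCycle (C α) →
        ReversesTo D C (Order.succ α) (G.reverse (C α))
  | limit (l : Ordinal.{u}) (G : Ordinal.{u} → Digraph V) :
      Order.IsSuccLimit l → (∀ ξ < l, ReversesTo D C ξ (G ξ)) → LocallyFiniteBelow C l →
        ReversesTo D C l (limitBelow G l)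

/-- The induced subdigraph of `D` on `S` is strong: any two of its vertices are joined, in both
directions, by directed paths that stay in `S`. -/
def IsStrongOn (D : Digraph V) (S : Set V) : Prop :=
  ∀ a ∈ S, ∀ b ∈ S, Relation.ReflTransGen (fun x y => x ∈ S ∧ y ∈ S ∧ D.Adj x y) a b

/-- `S` is (the vertex set of) a strong component of `D`: a maximal set of vertices that induces
a strong subdigraph. -/
def IsStrongComponent (D : Digraph V) (S : Set V) : Prop :=
  Maximal D.IsStrongOn S

end Digraph

/-! The proof is by induction on the cardinality κ of the vertex set. For infinite κ it suffices to
make all strong components smaller than κ: reversals inside different components do not interact,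
and they can only refine the components, so the components can then be treated separately
(`Breakable.of_comp`).

The basic tool is a way to flip a single arc. A finite divergence-free set of arcs splits into
directed cycles and can therefore be reversed. If an arc ab has infinitely many arc-disjoint return
paths P₀, P₁, … from b to a, reverse ab with P₀, then the reversed P₀ with P₁, and so on. Every path
is restored, every arc is used at most twice, and in the limit only ab is flipped
(`reversible_push`). For a whole set of arcs the return paths are chosen by transfinite recursion,
which works when each arc can be bypassed in sufficiently many ways (`reversible_flip`).

Call u linked to v if no cut with fewer than κ arcs separates u from v. Flip arcs so that one-way
linked pairs follow their linkage and mutually linked pairs follow a fixed well-order. A component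
that still has κ or more vertices must be crossed by a cut X with fewer than κ outgoing arcs, and
inside the component X is a barrier: all out-degrees outside X and all in-degrees inside X are below
κ (`breakable_of_barrier`).

Barriers are broken in two ways. For κ = ℵ₀, reversing pairs of rays removes the finitely many cut
arcs one at a time; the two sides then have finite in-degrees and finite out-degrees respectively,
and such tournaments are broken by reversing rays vertex by vertex. For uncountable κ, arcs are
flipped so that the restricted degree becomes constant on each component; a component is then
generated from a small set through small neighbourhoods, hence has fewer than κ vertices. -/

namespace Digraph

variable {V : Type u}

/-! ### Flips of symmetric sets of pairs and reversibility -/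

/-- The set of pairs that lie in `C` in one direction or the other. -/
def symmHull (C : Set (V × V)) : Set (V × V) := {p | p ∈ C ∨ p.swap ∈ C}

/-- The digraph `D` with all pairs in the (symmetric) set `N` reversed. -/
def flip (D : Digraph V) (N : Set (V × V)) : Digraph V where
  Adj a b := ((a, b) ∈ N ∧ D.Adj b a) ∨ ((a, b) ∉ N ∧ D.Adj a b)

/-- A set of pairs closed under swapping. -/
def IsSymmSet (N : Set (V × V)) : Prop := ∀ a b, (a, b) ∈ N → (b, a) ∈ N

/-- The pairs that lie in an odd number of the sets `N j`, `j ∈ I`. -/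
def oddSet {J : Type*} (N : J → Set (V × V)) (I : Set J) : Set (V × V) :=
  {p | Odd {j | j ∈ I ∧ p ∈ N j}.ncard}

/-- There is a locally finite reversal sequence of `D`, indexed by a well-ordered type, whose
cycles have all their arcs in `T`, and which in total reverses exactly the pairs in `N`. -/
def Reversible (D : Digraph V) (N T : Set (V × V)) : Prop :=
  ∃ (ι : Type u) (r : ι → ι → Prop) (_ : IsWellOrder ι r) (C : ι → Set (V × V)),
    (∀ p, {i | p ∈ symmHull (C i)}.Finite) ∧
    (∀ i, (D.flip (oddSet (fun j => symmHull (C j)) {j | r j i})).IsDirectedCycle (C i)) ∧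
    (∀ i, symmHull (C i) ⊆ T) ∧ N = oddSet (fun j => symmHull (C j)) Set.univ

theorem isSymmSet_symmHull (C : Set (V × V)) : IsSymmSet (symmHull C) := by
  intro a b h
  simpa [symmHull, or_comm] using h

theorem IsSymmSet.mem_comm {N : Set (V × V)} (h : IsSymmSet N) {a b : V} :
    (a, b) ∈ N ↔ (b, a) ∈ N := ⟨h a b, h b a⟩

theorem symmHull_iUnion {J : Type*} (C : J → Set (V × V)) :
    symmHull (⋃ j, C j) = ⋃ j, symmHull (C j) := by
  ext p
  simp [symmHull, exists_or]

theorem isSymmSet_oddSet {J : Type*} {N : J → Set (V × V)} (I : Set J)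
    (h : ∀ j, IsSymmSet (N j)) : IsSymmSet (oddSet N I) := by
  intro a b hab
  have : {j | j ∈ I ∧ (a, b) ∈ N j} = {j | j ∈ I ∧ (b, a) ∈ N j} := by
    ext j
    simp [(h j).mem_comm (a := a)]
  simpa [oddSet, this] using hab

theorem Reversible.isSymmSet {D : Digraph V} {N T : Set (V × V)} (h : Reversible D N T) :
    IsSymmSet N := by
  obtain ⟨ι, r, _, C, -, -, -, rfl⟩ := h
  exact isSymmSet_oddSet _ fun j => isSymmSet_symmHull _

theorem oddSet_subset {J : Type*} {N : J → Set (V × V)} {I : Set J} {T : Set (V × V)}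
    (h : ∀ j, N j ⊆ T) : oddSet N I ⊆ T := by
  intro p hp
  by_contra hpT
  have : {j | j ∈ I ∧ p ∈ N j} = ∅ := by
    ext j
    simpa using fun _ hj => hpT (h j hj)
  simp [oddSet, this] at hp

theorem Reversible.subset {D : Digraph V} {N T : Set (V × V)} (h : Reversible D N T) :
    N ⊆ T := by
  obtain ⟨ι, r, _, C, -, -, h, rfl⟩ := h
  exact oddSet_subset h

theorem Reversible.mono {D : Digraph V} {N T T' : Set (V × V)} (h : Reversible D N T)
    (hT : T ⊆ T') : Reversible D N T' := by
  obtain ⟨ι, r, w, C, h1, h2, h3, h4⟩ := h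
  exact ⟨ι, r, w, C, h1, h2, fun i => (h3 i).trans hT, h4⟩

theorem flip_adj_of_mem {D : Digraph V} {N : Set (V × V)} {a b : V} (h : (a, b) ∈ N) :
    (D.flip N).Adj a b ↔ D.Adj b a := by
  simp [flip, h]

theorem flip_adj_of_notMem {D : Digraph V} {N : Set (V × V)} {a b : V} (h : (a, b) ∉ N) :
    (D.flip N).Adj a b ↔ D.Adj a b := by
  simp [flip, h]

theorem flip_flip {D : Digraph V} {M : Set (V × V)} (hM : IsSymmSet M) (N : Set (V × V)) :
    (D.flip M).flip N = D.flip (symmDiff M N) := by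
  ext a b
  have := hM.mem_comm (a := a) (b := b)
  by_cases h1 : (a, b) ∈ M <;> by_cases h2 : (a, b) ∈ N <;>
    simp [flip, Set.mem_symmDiff, ← this, h1, h2]

@[simp]
theorem flip_empty (D : Digraph V) : D.flip ∅ = D := by
  ext a b
  simp [flip]

@[simp]
theorem oddSet_empty {J : Type*} (N : J → Set (V × V)) : oddSet N ∅ = ∅ := by
  ext p
  simp [oddSet]

theorem IsTournament.flip {D : Digraph V} (hD : D.IsTournament) {N : Set (V × V)}
    (hN : IsSymmSet N) : (D.flip N).IsTournament := by
  refine ⟨fun a => ?_, fun a b hab => ?_⟩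
  · simp [Digraph.flip, hD.1]
  · have h1 := hD.2 a b hab
    have h2 := hN.mem_comm (a := a) (b := b)
    by_cases h : (a, b) ∈ N
    · rw [flip_adj_of_mem h, flip_adj_of_mem (h2.1 h)]
      tauto
    · rw [flip_adj_of_notMem h, flip_adj_of_notMem (fun h' => h (h2.2 h'))]
      tauto

theorem IsTournament.asymm {D : Digraph V} (hD : D.IsTournament) {a b : V} (h : D.Adj a b) :
    ¬ D.Adj b a :=
  (hD.2 a b (by rintro rfl; exact hD.1 a h)).1 h

theorem IsTournament.ne {D : Digraph V} (hD : D.IsTournament) {a b : V} (h : D.Adj a b) :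
    a ≠ b := by
  rintro rfl
  exact hD.1 a h

theorem IsTournament.adj_of_not {D : Digraph V} (hD : D.IsTournament) {a b : V} (hab : a ≠ b)
    (h : ¬ D.Adj a b) : D.Adj b a :=
  (hD.2 b a hab.symm).2 h

theorem IsDirectedCycle.of_agree {D D' : Digraph V} {C : Set (V × V)} (h : D.IsDirectedCycle C)
    (h' : ∀ a b, (a, b) ∈ C → D.Adj a b → D'.Adj a b) : D'.IsDirectedCycle C := by
  obtain ⟨n, hn, x, hx, hadj, rfl⟩ := h
  exact ⟨n, hn, x, hx, fun i => h' _ _ ⟨i, rfl⟩ (hadj i), rfl⟩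

/-- Reversibility only depends on the arcs in `T`. -/
theorem Reversible.of_agree {D D' : Digraph V} {N T : Set (V × V)} (h : Reversible D N T)
    (hDD : ∀ a b, (a, b) ∈ T → (D.Adj a b ↔ D'.Adj a b)) : Reversible D' N T := by
  obtain ⟨ι, r, w, C, h1, h2, h3, h4⟩ := h
  refine ⟨ι, r, w, C, h1, fun i => (h2 i).of_agree fun a b hab => ?_, h3, h4⟩
  have e1 := hDD a b (h3 i (Or.inl hab))
  have e2 := hDD b a (h3 i (Or.inr hab))
  simp [flip, e1, e2]

theorem reversible_empty (D : Digraph V) (T : Set (V × V)) : Reversible D ∅ T :=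
  ⟨PEmpty, emptyRelation, inferInstance, fun _ => ∅, fun p => Set.toFinite _, fun i => i.elim,
    fun i => i.elim, by ext p; simp [oddSet, Set.eq_empty_of_isEmpty]⟩

/-! ### Parity counting and concatenation of reversals -/

theorem odd_ncard_sigma {J : Type*} {ι : J → Type*} {s : Set (Σ j, ι j)} (hs : s.Finite) :
    Odd s.ncard ↔ Odd {j | Odd {i | (⟨j, i⟩ : Σ j, ι j) ∈ s}.ncard}.ncard := by
  classical
  lift s to Finset (Σ j, ι j) using hs
  have h1 : ∀ j, {i | (⟨j, i⟩ : Σ j, ι j) ∈ (s : Set (Σ j, ι j))}.ncard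
      = (s.filter fun p => p.1 = j).card := by
    intro j
    rw [← Set.ncard_coe_finset]
    rw [← Set.ncard_image_of_injective _ (sigma_mk_injective (i := j))]
    congr 1
    ext ⟨j', i⟩
    simp only [Set.mem_image, Set.mem_ofPred_eq, Finset.coe_filter, Finset.mem_coe]
    constructor
    · rintro ⟨x, hx, h⟩
      cases h
      exact ⟨hx, rfl⟩
    · rintro ⟨hx, rfl⟩
      exact ⟨i, hx, rfl⟩
  rw [Set.ncard_coe_finset, Finset.card_eq_sum_card_image Sigma.fst s,
    Finset.odd_sum_iff_odd_card_odd, ← Set.ncard_coe_finset]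
  simp_rw [h1]
  congr! 2
  ext j
  simp only [Finset.coe_filter, Finset.mem_image, Set.mem_ofPred_eq, and_iff_right_iff_imp]
  intro h
  obtain ⟨p, hp⟩ := Finset.card_pos.1 h.pos
  exact ⟨p, by simpa using hp⟩

theorem isWellOrder_sigma_lex {J : Type*} {ι : J → Type*} (r : J → J → Prop)
    (s : ∀ j, ι j → ι j → Prop) [IsWellOrder J r] [∀ j, IsWellOrder (ι j) (s j)] :
    IsWellOrder (Σ j, ι j) (Sigma.Lex r s) := by
  have wf : WellFounded (Sigma.Lex r s) := by
    refine ⟨fun ⟨j, i⟩ => ?_⟩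
    induction j using (IsWellFounded.wf (r := r)).induction with
    | _ j ihj =>
      induction i using (IsWellFounded.wf (r := s j)).induction with
      | _ i ihi =>
        refine Acc.intro _ ?_
        rintro ⟨j', i'⟩ (⟨_, _, h⟩ | ⟨_, _, h⟩)
        · exact ihj _ h _
        · exact ihi _ h
  exact { wf := wf, trichotomous := Std.Trichotomous.trichotomous }

/-- Concatenation of a locally finite well-ordered family of reversals. -/
theorem Reversible.concat {D : Digraph V} {J : Type u} (r : J → J → Prop) [IsWellOrder J r]
    {N T : J → Set (V × V)}
    (h : ∀ j, Reversible (D.flip (oddSet N {i | r i j})) (N j) (T j))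
    (hT : ∀ p, {j | p ∈ T j}.Finite) :
    Reversible D (oddSet N Set.univ) (⋃ j, T j) := by
  have hN : ∀ j, IsSymmSet (N j) := fun j => (h j).isSymmSet
  choose ι s w C hfin hcyc hCT hNC using h
  have key : ∀ p, {q : Σ j, ι j | p ∈ symmHull (C q.1 q.2)}.Finite := by
    intro p
    refine ((hT p).biUnion fun j _ => (hfin j p).image (Sigma.mk j)).subset ?_
    rintro ⟨j, i⟩ hq
    simp only [Set.mem_iUnion]
    exact ⟨j, hCT j i hq, i, hq, rfl⟩
  -- Counting block by block: the number of cycles through a pair is odd iff an odd number of blocks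
  -- contain it an odd number of times.
  have parity : ∀ I : Set J, oddSet (fun q : Σ j, ι j => symmHull (C q.1 q.2)) {q | q.1 ∈ I}
      = oddSet N I := by
    intro I
    ext p
    have hf : {q : Σ j, ι j | q.1 ∈ I ∧ p ∈ symmHull (C q.1 q.2)}.Finite :=
      (key p).subset fun q hq => hq.2
    have e : {j | j ∈ I ∧ p ∈ N j} = {j | Odd {i | (⟨j, i⟩ : Σ j, ι j) ∈
        {q : Σ j, ι j | q.1 ∈ I ∧ p ∈ symmHull (C q.1 q.2)}}.ncard} := by
      ext j
      by_cases hj : j ∈ I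
      · simp [hj, hNC j, oddSet]
      · simp [hj]
    simp only [oddSet, Set.mem_ofPred_eq] at e ⊢
    rw [e]
    exact odd_ncard_sigma hf
  -- The cycles before position `(j, i)` are all cycles of the blocks before `j` and an initial
  -- segment of block `j`, so their parities combine by symmetric difference.
  have state : ∀ j i, oddSet (fun q : Σ j, ι j => symmHull (C q.1 q.2))
      {q | Sigma.Lex r s q ⟨j, i⟩} =
      symmDiff (oddSet N {i | r i j}) (oddSet (fun i => symmHull (C j i)) {i' | s j i' i}) := by
    intro j i
    rw [← parity]
    ext p
    have e : {q | q ∈ {q | Sigma.Lex r s q ⟨j, i⟩} ∧ p ∈ symmHull (C q.1 q.2)} =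
        {q : Σ j, ι j | q.1 ∈ {i | r i j} ∧ p ∈ symmHull (C q.1 q.2)} ∪
        Sigma.mk j '' {i' | i' ∈ {i' | s j i' i} ∧ p ∈ symmHull (C j i')} := by
      ext ⟨j', i'⟩
      simp only [Set.mem_ofPred_eq, Set.mem_union, Set.mem_image]
      constructor
      · rintro ⟨⟨_, _, h⟩ | ⟨_, _, h⟩, h'⟩
        · exact Or.inl ⟨h, h'⟩
        · exact Or.inr ⟨_, ⟨h, h'⟩, rfl⟩
      · rintro (⟨h, h'⟩ | ⟨x, ⟨h, h'⟩, e⟩)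
        · exact ⟨Sigma.Lex.left _ _ h, h'⟩
        · cases e
          exact ⟨Sigma.Lex.right _ _ h, h'⟩
    have hd : Disjoint {q : Σ j, ι j | q.1 ∈ {i | r i j} ∧ p ∈ symmHull (C q.1 q.2)}
        (Sigma.mk j '' {i' | i' ∈ {i' | s j i' i} ∧ p ∈ symmHull (C j i')}) := by
      rw [Set.disjoint_left]
      rintro _ ⟨h, -⟩ ⟨x, -, rfl⟩
      exact irrefl_of r _ h
    rw [Set.mem_symmDiff]
    simp only [oddSet] at e hd ⊢
    simp only [Set.mem_ofPred_eq] at e hd ⊢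
    rw [e, Set.ncard_union_eq hd ((key p).subset fun q hq => hq.2)
      (((hfin j p).subset fun q hq => hq.2).image _),
      Set.ncard_image_of_injective _ sigma_mk_injective, Nat.odd_add, ← Nat.not_odd_iff_even]
    tauto
  refine ⟨Σ j, ι j, Sigma.Lex r s, isWellOrder_sigma_lex r s, fun q => C q.1 q.2, key, ?_,
    fun q => (hCT q.1 q.2).trans (Set.subset_iUnion T q.1), ?_⟩
  · rintro ⟨j, i⟩
    rw [state, ← flip_flip (isSymmSet_oddSet _ hN)]
    exact hcyc j i
  · simpa using (parity Set.univ).symm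

theorem oddSet_univ_eq_iUnion {J : Type*} {N : J → Set (V × V)}
    (h : ∀ i j p, p ∈ N i → p ∈ N j → i = j) : oddSet N Set.univ = ⋃ j, N j := by
  ext p
  simp only [oddSet, Set.mem_univ, true_and, Set.mem_ofPred_eq, Set.mem_iUnion]
  constructor
  · intro ho
    by_contra! hne
    simp [hne] at ho
  · rintro ⟨j, hj⟩
    have : {j | p ∈ N j} = {j} := by
      ext i
      exact ⟨fun hi => h _ _ _ hi hj, by rintro rfl; exact hj⟩
    simp [this]

theorem oddSet_eq_biUnion {J : Type*} {N : J → Set (V × V)} (I : Set J)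
    (h : ∀ i j p, p ∈ N i → p ∈ N j → i = j) : oddSet N I = ⋃ j ∈ I, N j := by
  ext p
  simp only [oddSet, Set.mem_ofPred_eq, Set.mem_iUnion]
  constructor
  · intro ho
    by_contra! hne
    have : {j | j ∈ I ∧ p ∈ N j} = ∅ := by
      ext j
      simpa using hne j
    simp [this] at ho
  · rintro ⟨j, hjI, hj⟩
    have : {j | j ∈ I ∧ p ∈ N j} = {j} := by
      ext i
      exact ⟨fun hi => h _ _ _ hi.2 hj, by rintro rfl; exact ⟨hjI, hj⟩⟩
    simp [this]

theorem oddSet_insert {J : Type*} {N : J → Set (V × V)} {I : Set J} {i : J} (hi : i ∉ I)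
    (hfin : ∀ p, {j | j ∈ I ∧ p ∈ N j}.Finite) :
    oddSet N (insert i I) = symmDiff (oddSet N I) (N i) := by
  ext p
  rw [Set.mem_symmDiff]
  by_cases hp : p ∈ N i
  · have e : {j | j ∈ insert i I ∧ p ∈ N j} = insert i {j | j ∈ I ∧ p ∈ N j} := by
      ext j
      simp only [Set.mem_ofPred_eq, Set.mem_insert_iff]
      constructor
      · tauto
      · rintro (rfl | h)
        · exact ⟨Or.inl rfl, hp⟩
        · exact ⟨Or.inr h.1, h.2⟩
    simp only [oddSet, Set.mem_ofPred_eq] at e ⊢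
    rw [e, Set.ncard_insert_of_notMem (fun h => hi h.1) (hfin p), Nat.odd_add_one]
    tauto
  · have e : {j | j ∈ insert i I ∧ p ∈ N j} = {j | j ∈ I ∧ p ∈ N j} := by
      ext j
      simp only [Set.mem_ofPred_eq, Set.mem_insert_iff]
      constructor
      · rintro ⟨rfl | h, h'⟩
        · exact absurd h' hp
        · exact ⟨h, h'⟩
      · tauto
    simp only [oddSet, Set.mem_ofPred_eq] at e ⊢
    rw [e]
    tauto

/-- Concatenation of an `ω`-sequence of reversals. -/
theorem Reversible.concat_nat {D : ℕ → Digraph V} {N T : ℕ → Set (V × V)}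
    (h : ∀ n, Reversible (D n) (N n) (T n)) (hD : ∀ n, D (n + 1) = (D n).flip (N n))
    (hT : ∀ p, {n | p ∈ T n}.Finite) :
    Reversible (D 0) (oddSet N Set.univ) (⋃ n, T n) ∧
      ∀ n, D n = (D 0).flip (oddSet N (Set.Iio n)) := by
  have hN : ∀ n, IsSymmSet (N n) := fun n => (h n).isSymmSet
  have state : ∀ n, D n = (D 0).flip (oddSet N (Set.Iio n)) := by
    intro n
    induction n with
    | zero => simp
    | succ n ih =>
      rw [hD, ih, flip_flip (isSymmSet_oddSet _ hN)]
      have : Set.Iio (n + 1) = insert n (Set.Iio n) := by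
        ext j
        simp [le_iff_eq_or_lt]
      rw [this, oddSet_insert (by simp) fun p => (Set.finite_Iio n).subset fun q hq => hq.1]
  refine ⟨?_, state⟩
  -- Index types of reversals live in `Type u`, so ℕ has to be lifted.
  have ulift : ∀ I : Set ℕ,
      oddSet (fun j : ULift.{u} ℕ => N j.down) {j | j.down ∈ I} = oddSet N I := by
    intro I
    ext p
    have : {j : ULift.{u} ℕ | j ∈ {j : ULift.{u} ℕ | j.down ∈ I} ∧ p ∈ N j.down} =
        ULift.up '' {j | j ∈ I ∧ p ∈ N j} := by
      ext ⟨j⟩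
      simp
    simp only [oddSet, Set.mem_ofPred_eq] at this ⊢
    rw [this, Set.ncard_image_of_injective _ ULift.up_injective]
  have := Reversible.concat (D := D 0) (J := ULift.{u} ℕ) (fun i j => i < j)
    (N := fun j => N j.down) (T := fun j => T j.down) (fun j => by
      have e : {i : ULift.{u} ℕ | i < j} = {i | i.down ∈ Set.Iio j.down} := rfl
      rw [e, ulift, ← state]
      exact h j.down)
    (fun p => (hT p).preimage (f := ULift.down) ULift.down_injective.injOn)
  rw [← ulift]
  refine (by simpa using this : Reversible (D 0) _ _).mono (Set.iUnion_subset fun j => ?_)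
  exact Set.subset_iUnion T j.down

/-- An ω-concatenation in which all blocks after the second are empty. -/
theorem Reversible.trans {D : Digraph V} {N M T T' : Set (V × V)} (h : Reversible D N T)
    (h' : Reversible (D.flip N) M T') : Reversible D (symmDiff N M) (T ∪ T') := by
  have hs := h.isSymmSet
  let D' : ℕ → Digraph V := fun n =>
    match n with
    | 0 => D
    | 1 => D.flip N
    | _ => D.flip (symmDiff N M)
  let N' : ℕ → Set (V × V) := fun n =>
    match n with
    | 0 => N
    | 1 => M
    | _ => ∅
  let T'' : ℕ → Set (V × V) := fun n =>
    match n with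
    | 0 => T
    | 1 => T'
    | _ => ∅
  have key := Reversible.concat_nat (D := D') (N := N') (T := T'')
    (fun n => by
      match n with
      | 0 => exact h
      | 1 => exact h'
      | n + 2 => exact reversible_empty _ _)
    (fun n => by
      match n with
      | 0 => rfl
      | 1 => exact (flip_flip hs M).symm
      | n + 2 => exact (flip_empty _).symm)
    (fun p => by
      refine (Set.finite_Iio 2).subset fun n hn => ?_
      match n with
      | 0 => simp
      | 1 => simp
      | n + 2 => exact hn.elim)
  have e : oddSet N' Set.univ = symmDiff N M := by
    ext p
    have e1 : {j | j ∈ Set.univ ∧ p ∈ N' j} = {j | j = 0 ∧ p ∈ N} ∪ {j | j = 1 ∧ p ∈ M} := by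
      ext j
      match j with
      | 0 => simp [N']
      | 1 => simp [N']
      | n + 2 => simp [N']
    rw [Set.mem_symmDiff]
    simp only [oddSet, Set.mem_ofPred_eq] at e1 ⊢
    rw [e1]
    by_cases h1 : p ∈ N <;> by_cases h2 : p ∈ M <;> simp [h1, h2]
  rw [e] at key
  refine key.1.mono (Set.iUnion_subset fun n => ?_)
  match n with
  | 0 => exact Set.subset_union_left
  | 1 => exact Set.subset_union_right
  | n + 2 => exact Set.empty_subset _

/-! ### Opposite and induced digraphs -/

/-- The digraph with all arcs reversed. -/
def op (D : Digraph V) : Digraph V where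
  Adj a b := D.Adj b a

/-- The subdigraph induced on a set, as a digraph on the subtype. -/
def induced (D : Digraph V) (K : Set V) : Digraph K where
  Adj a b := D.Adj a b

theorem op_flip (D : Digraph V) {N : Set (V × V)} (hN : IsSymmSet N) :
    (D.flip N).op = D.op.flip N := by
  ext a b
  simp [op, flip, hN.mem_comm (a := a)]

theorem IsTournament.op {D : Digraph V} (hD : D.IsTournament) : D.op.IsTournament :=
  ⟨hD.1, fun a b hab => hD.2 b a hab.symm⟩

theorem IsTournament.induced {D : Digraph V} (hD : D.IsTournament) (K : Set V) :
    (D.induced K).IsTournament :=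
  ⟨fun a => hD.1 a, fun a b hab => hD.2 a b fun h => hab (Subtype.ext h)⟩

theorem IsDirectedCycle.op {D : Digraph V} {C : Set (V × V)} (h : D.IsDirectedCycle C) :
    D.op.IsDirectedCycle (Prod.swap '' C) := by
  obtain ⟨n, hn, x, hx, hadj, rfl⟩ := h
  refine ⟨n, hn, fun i => x (-i), fun i j hij => neg_injective (hx hij), fun i => ?_, ?_⟩
  · have := hadj (-(i + 1))
    rwa [neg_add, neg_add_cancel_right, ← neg_add] at this
  · ext ⟨a, b⟩
    simp only [Set.mem_image, Set.mem_range, exists_exists_eq_and, Prod.swap_prod_mk]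
    constructor
    · rintro ⟨i, h⟩
      exact ⟨-(i + 1), by simpa using h⟩
    · rintro ⟨i, h⟩
      exact ⟨-(i + 1), by simpa using h⟩

theorem symmHull_image_swap (C : Set (V × V)) : symmHull (Prod.swap '' C) = symmHull C := by
  ext ⟨a, b⟩
  simp [symmHull, or_comm]

/-- A directed cycle read backwards is a directed cycle of the opposite digraph. This lets
statements about in-degrees be deduced from those about out-degrees. -/
theorem Reversible.op {D : Digraph V} {N T : Set (V × V)} (h : Reversible D N T) :
    Reversible D.op N T := by
  obtain ⟨ι, r, w, C, h1, h2, h3, h4⟩ := h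
  refine ⟨ι, r, w, fun i => Prod.swap '' C i, ?_, fun i => ?_, ?_, ?_⟩
  · simpa only [symmHull_image_swap]
  · simp only [symmHull_image_swap]
    rw [← op_flip _ (isSymmSet_oddSet _ fun j => isSymmSet_symmHull _)]
    exact (h2 i).op
  · simpa only [symmHull_image_swap]
  · simpa only [symmHull_image_swap]

/-- A reversal of an induced subdigraph is a reversal of the whole digraph. -/
theorem Reversible.of_induced {D : Digraph V} {K : Set V} {N T : Set (K × K)}
    (h : Reversible (D.induced K) N T) :
    Reversible D (Prod.map Subtype.val Subtype.val '' N)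
      (Prod.map Subtype.val Subtype.val '' T) := by
  obtain ⟨ι, r, w, C, h1, h2, h3, h4⟩ := h
  have hinj : Function.Injective (Prod.map (Subtype.val : K → V) (Subtype.val : K → V)) :=
    Subtype.val_injective.prodMap Subtype.val_injective
  have hull : ∀ C : Set (K × K), symmHull (Prod.map Subtype.val Subtype.val '' C) =
      Prod.map (Subtype.val : K → V) (Subtype.val : K → V) '' symmHull C := by
    intro C
    ext ⟨a, b⟩
    simp only [symmHull, Set.mem_ofPred_eq, Set.mem_image, Prod.exists, Prod.map_apply,
      Prod.swap_prod_mk, Prod.mk.injEq]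
    constructor
    · rintro (⟨x, y, h, rfl, rfl⟩ | ⟨x, y, h, rfl, rfl⟩)
      · exact ⟨x, y, Or.inl h, rfl, rfl⟩
      · exact ⟨y, x, Or.inr h, rfl, rfl⟩
    · rintro ⟨x, y, h | h, rfl, rfl⟩
      · exact Or.inl ⟨x, y, h, rfl, rfl⟩
      · exact Or.inr ⟨y, x, h, rfl, rfl⟩
  have odd : ∀ I : Set ι, oddSet (fun i => symmHull (Prod.map Subtype.val Subtype.val '' C i)) I =
      Prod.map (Subtype.val : K → V) (Subtype.val : K → V) ''
        oddSet (fun i => symmHull (C i)) I := by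
    intro I
    simp only [hull]
    ext p
    by_cases hp : p ∈ Set.range (Prod.map (Subtype.val : K → V) (Subtype.val : K → V))
    · obtain ⟨q, rfl⟩ := hp
      rw [hinj.mem_set_image]
      simp only [oddSet, Set.mem_ofPred_eq, hinj.mem_set_image]
    · have h' : ∀ S : Set (K × K),
          p ∉ Prod.map (Subtype.val : K → V) (Subtype.val : K → V) '' S :=
        fun S hS => hp (Set.image_subset_range _ _ hS)
      simp only [oddSet, Set.mem_ofPred_eq, h', and_false, Set.ofPred_false, Set.ncard_empty]
      simp
  refine ⟨ι, r, w, fun i => Prod.map Subtype.val Subtype.val '' C i, fun p => ?_, fun i => ?_,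
    fun i => ?_, ?_⟩
  · simp only [hull]
    by_cases hp : p ∈ Set.range (Prod.map (Subtype.val : K → V) (Subtype.val : K → V))
    · obtain ⟨q, rfl⟩ := hp
      simp only [hinj.mem_set_image]
      exact h1 q
    · have h' : ∀ S : Set (K × K),
          p ∉ Prod.map (Subtype.val : K → V) (Subtype.val : K → V) '' S :=
        fun S hS => hp (Set.image_subset_range _ _ hS)
      simp [h' _]
  · rw [odd]
    obtain ⟨n, hn, x, hx, hadj, hC⟩ := h2 i
    refine ⟨n, hn, fun j => x j, Subtype.val_injective.comp hx, fun j => ?_, ?_⟩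
    · have hmem : ∀ a b : K, ((a : V), (b : V)) ∈ Prod.map (Subtype.val : K → V)
          (Subtype.val : K → V) '' oddSet (fun i => symmHull (C i)) {j | r j i} ↔
          (a, b) ∈ oddSet (fun i => symmHull (C i)) {j | r j i} :=
        fun a b => hinj.mem_set_image (s := oddSet (fun i => symmHull (C i)) {j | r j i})
          (a := (a, b))
      have := hadj j
      simpa [flip, induced, hmem] using this
    · change _ '' C i = _
      rw [hC, ← Set.range_comp]
      rfl
  · rw [hull]
    exact Set.image_mono (h3 i)
  · rw [odd, h4]

/-! ### Strong components -/

/-- `b` can be reached from `a` by a directed path. -/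
def Reach (D : Digraph V) : V → V → Prop := Relation.ReflTransGen D.Adj

/-- `a` and `b` lie in the same strong component. -/
def Conn (D : Digraph V) (a b : V) : Prop := D.Reach a b ∧ D.Reach b a

/-- The strong component of `a`. -/
def comp (D : Digraph V) (a : V) : Set V := {b | D.Conn a b}

/-- `D` has a locally finite reversal sequence after which all strong components have fewer than
`κ` vertices. -/
def Breakable (κ : Cardinal.{u}) (D : Digraph V) : Prop :=
  ∃ N, Reversible D N Set.univ ∧ ∀ a, Cardinal.mk ((D.flip N).comp a) < κ

theorem Conn.refl (D : Digraph V) (a : V) : D.Conn a a := ⟨.refl, .refl⟩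

theorem Conn.symm {D : Digraph V} {a b : V} (h : D.Conn a b) : D.Conn b a := ⟨h.2, h.1⟩

theorem Conn.trans {D : Digraph V} {a b c : V} (h : D.Conn a b) (h' : D.Conn b c) :
    D.Conn a c := ⟨Relation.ReflTransGen.trans h.1 h'.1, Relation.ReflTransGen.trans h'.2 h.2⟩

theorem Conn.comp_eq {D : Digraph V} {a b : V} (h : D.Conn a b) : D.comp a = D.comp b :=
  Set.ext fun _ => ⟨fun h' => h.symm.trans h', fun h' => h.trans h'⟩

theorem reach_op {D : Digraph V} {a b : V} : D.op.Reach a b ↔ D.Reach b a :=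
  Relation.reflTransGen_swap

theorem comp_op (D : Digraph V) (a : V) : D.op.comp a = D.comp a := by
  ext b
  simp [comp, Conn, reach_op, and_comm]

/-- A path between vertices of one strong component stays in that component. -/
theorem Conn.reach_within {D : Digraph V} {a b : V} (h : D.Conn a b) :
    Relation.ReflTransGen (fun x y => x ∈ D.comp a ∧ y ∈ D.comp a ∧ D.Adj x y) a b := by
  obtain ⟨h1, h2⟩ := h
  induction h1 with
  | refl => exact .refl
  | @tail c d h1 hcd ih =>
    have hda : D.Reach d a := h2
    have hca : D.Reach c a := Relation.ReflTransGen.head hcd hda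
    exact (ih hca).tail ⟨⟨h1, hca⟩, ⟨h1.tail hcd, hda⟩, hcd⟩

theorem Conn.induced {D : Digraph V} {K : Set V} {a b : V} (ha : a ∈ K) (hb : b ∈ K)
    (h : D.Conn a b) (hK : D.comp a ⊆ K) : (D.induced K).Conn ⟨a, ha⟩ ⟨b, hb⟩ := by
  have key : ∀ {x y : V} (_ : Relation.ReflTransGen
      (fun x y => x ∈ D.comp a ∧ y ∈ D.comp a ∧ D.Adj x y) x y) (hx : x ∈ K) (hy : y ∈ K),
      (D.induced K).Reach ⟨x, hx⟩ ⟨y, hy⟩ := by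
    intro x y hxy hx
    induction hxy with
    | refl => exact fun _ => .refl
    | tail _ hcd ih => exact fun hy => (ih (hK hcd.1)).tail hcd.2.2
  refine ⟨key h.reach_within ha hb, key ?_ hb ha⟩
  have := h.symm.reach_within
  rwa [← h.comp_eq] at this

/-- Each arc created by the flip can be replaced by an old path. Hence flips inside strong
components never merge components. -/
theorem reach_flip {D : Digraph V} {N : Set (V × V)} (hN : ∀ a b, (a, b) ∈ N → D.Reach a b)
    {a b : V} (h : (D.flip N).Reach a b) : D.Reach a b := by
  induction h with
  | refl => exact .refl
  | @tail c d _ hcd ih =>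
    rcases hcd with ⟨h, -⟩ | ⟨-, h⟩
    · exact ih.trans (hN _ _ h)
    · exact ih.tail h

theorem conn_flip {D : Digraph V} {N : Set (V × V)} (hN : ∀ a b, (a, b) ∈ N → D.Reach a b)
    {a b : V} (h : (D.flip N).Conn a b) : D.Conn a b :=
  ⟨reach_flip hN h.1, reach_flip hN h.2⟩

theorem Breakable.op {D : Digraph V} {κ : Cardinal.{u}} (h : Breakable κ D) :
    Breakable κ D.op := by
  obtain ⟨N, h1, h2⟩ := h
  refine ⟨N, h1.op, fun a => ?_⟩
  rw [← op_flip _ h1.isSymmSet, comp_op]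
  exact h2 a

theorem Breakable.of_reversible {D : Digraph V} {κ : Cardinal.{u}} {N T : Set (V × V)}
    (h : Reversible D N T) (h' : Breakable κ (D.flip N)) : Breakable κ D := by
  obtain ⟨M, h1, h2⟩ := h'
  refine ⟨symmDiff N M, (h.trans h1).mono (Set.subset_univ _), ?_⟩
  rwa [← flip_flip h.isSymmSet]

theorem breakable_of_comp_lt {D : Digraph V} {κ : Cardinal.{u}}
    (h : ∀ a, Cardinal.mk (D.comp a) < κ) : Breakable κ D :=
  ⟨∅, reversible_empty _ _, by simpa using h⟩

/-- It suffices to break every strong component. -/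
theorem Breakable.of_comp {D : Digraph V} {κ : Cardinal.{u}}
    (h : ∀ a, Breakable κ (D.induced (D.comp a))) : Breakable κ D := by
  let s : Setoid V := ⟨D.Conn, Conn.refl D, Conn.symm, Conn.trans⟩
  let J := Quotient s
  let q : V → J := Quotient.mk s
  let K : J → Set V := fun j => D.comp j.out
  have hmem : ∀ a, a ∈ K (q a) := fun a => Quotient.mk_out (s := s) a
  have hK : ∀ j a, a ∈ K j → j = (q a) := fun j a ha => by
    rw [← Quotient.out_eq j]
    exact Quotient.sound ha
  choose N hN hκ using fun j : J => h j.out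
  let M : J → Set (V × V) := fun j => Prod.map Subtype.val Subtype.val '' N j
  have hMK : ∀ j, M j ⊆ K j ×ˢ K j := by
    rintro j _ ⟨⟨x, y⟩, -, rfl⟩
    exact ⟨x.2, y.2⟩
  have hdisj : ∀ i j p, p ∈ K i ×ˢ K i → p ∈ K j ×ˢ K j → i = j := fun i j p hi hj =>
    (hK i _ hi.1).trans (hK j _ hj.1).symm
  have hdisj' : ∀ i j p, p ∈ M i → p ∈ M j → i = j := fun i j p hi hj =>
    hdisj i j p (hMK i hi) (hMK j hj)
  have hrev : Reversible D (⋃ j, M j) (⋃ j, K j ×ˢ K j) := by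
    rw [← oddSet_univ_eq_iUnion hdisj']
    -- Distinct components share no pairs, so the order of the blocks is immaterial and any
    -- well-order serves.
    refine Reversible.concat WellOrderingRel (fun j => ?_) fun p => ?_
    · refine ((hN j).of_induced.mono (T' := K j ×ˢ K j) ?_).of_agree fun a b hab => ?_
      · rintro _ ⟨⟨x, y⟩, -, rfl⟩
        exact ⟨x.2, y.2⟩
      · rw [flip_adj_of_notMem]
        rw [oddSet_eq_biUnion _ hdisj']
        simp only [Set.mem_iUnion, not_exists]
        rintro i hi hab'
        have := hdisj i j _ (hMK i hab') hab
        subst this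
        exact irrefl_of WellOrderingRel _ hi
    · exact Set.Subsingleton.finite fun i hi j hj => hdisj i j p hi hj
  refine ⟨⋃ j, M j, hrev.mono (Set.subset_univ _), fun a => ?_⟩
  have hreach : ∀ a b, (a, b) ∈ ⋃ j, M j → D.Reach a b := by
    intro a b hab
    obtain ⟨j, hj⟩ := Set.mem_iUnion.1 hab
    have := hMK j hj
    exact (Conn.trans (Conn.symm this.1) this.2).1
  have hind : (D.flip (⋃ j, M j)).induced (K (q a)) = (D.induced (K (q a))).flip (N (q a)) := by
    have hinj : Function.Injective
        (Prod.map (Subtype.val : K (q a) → V) (Subtype.val : K (q a) → V)) :=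
      Subtype.val_injective.prodMap Subtype.val_injective
    have : ∀ x y : K (q a), ((x : V), (y : V)) ∈ ⋃ j, M j ↔ (x, y) ∈ N (q a) := by
      intro x y
      rw [← hinj.mem_set_image, Set.mem_iUnion]
      constructor
      · rintro ⟨j, hj⟩
        have := hdisj j _ _ (hMK j hj) ⟨x.2, y.2⟩
        subst this
        exact hj
      · exact fun h => ⟨_, h⟩
    ext x y
    simp only [Digraph.induced, Digraph.flip, this]
  refine lt_of_le_of_lt ?_ (hκ (q a) ⟨a, hmem a⟩)
  have hsub : ∀ b ∈ (D.flip (⋃ j, M j)).comp a, b ∈ K (q a) := fun b hb =>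
    Conn.trans (hmem a) (conn_flip hreach hb)
  refine Cardinal.mk_le_of_injective (f := fun b => ⟨⟨b.1, hsub b.1 b.2⟩, ?_⟩) ?_
  · have := Conn.induced (hmem a) (hsub b.1 b.2) b.2 hsub
    rw [hind] at this
    exact this
  · intro b c hbc
    simpa [Subtype.ext_iff] using hbc

/-! ### From indexed reversals to transfinite reversal sequences -/

theorem IsStrongOn.subset_comp {D : Digraph V} {S : Set V} (h : D.IsStrongOn S) {a : V}
    (ha : a ∈ S) : S ⊆ D.comp a := fun b hb =>
  ⟨Relation.ReflTransGen.mono (fun _ _ h => h.2.2) _ _ (h a ha b hb),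
    Relation.ReflTransGen.mono (fun _ _ h => h.2.2) _ _ (h b hb a ha)⟩

theorem IsDirectedCycle.adj {G : Digraph V} {C : Set (V × V)} (h : G.IsDirectedCycle C) {a b : V}
    (hab : (a, b) ∈ C) : G.Adj a b := by
  obtain ⟨n, -, x, -, hadj, rfl⟩ := h
  obtain ⟨i, hi⟩ := hab
  cases hi
  exact hadj i

/-- In a tournament the reverse of a cycle arc is never an arc, so the oriented reversal only
depends on the unordered pairs. -/
theorem reverse_eq_flip {G : Digraph V} (hG : G.IsTournament) {C : Set (V × V)}
    (hC : G.IsDirectedCycle C) : G.reverse C = G.flip (symmHull C) := by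
  ext a b
  by_cases h1 : (a, b) ∈ C
  · have := hG.asymm (hC.adj h1)
    have h2 : (b, a) ∉ C := fun h => this (hC.adj h)
    simp [reverse, flip, symmHull, h1, h2, this]
  · by_cases h2 : (b, a) ∈ C
    · simp [reverse, flip, symmHull, h2, hC.adj h2]
    · simp [reverse, flip, symmHull, h1, h2]

/-- Reversals indexed by a well-ordered type yield reversal sequences. -/
theorem Reversible.exists_reversesTo {D : Digraph V} (hD : D.IsTournament) {N T : Set (V × V)}
    (h : Reversible D N T) :
    ∃ (α : Ordinal.{u}) (C : Ordinal.{u} → Set (V × V)),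
      LocallyFiniteBelow C α ∧ D.ReversesTo C α (D.flip N) := by
  obtain ⟨ι, r, w, C, h1, h2, -, rfl⟩ := h
  obtain ⟨α, hα⟩ : ∃ α, α = Ordinal.type r := ⟨_, rfl⟩
  -- The cycle whose index has position `ξ` in the well-order; empty from `α` on.
  let C' : Ordinal.{u} → Set (V × V) := fun ξ =>
    {p | ∃ i, Ordinal.typein r i = ξ ∧ p ∈ C i}
  have hC' : ∀ i, C' (Ordinal.typein r i) = C i := by
    intro i
    ext p
    constructor
    · rintro ⟨j, hj, hp⟩
      rwa [← Ordinal.typein_injective r hj]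
    · exact fun hp => ⟨i, rfl, hp⟩
  have hlf : ∀ l, LocallyFiniteBelow C' l := by
    intro l a b
    refine ((h1 (a, b)).image (Ordinal.typein r)).subset ?_
    rintro _ ⟨-, i, rfl, hi⟩
    exact ⟨i, Or.inl hi, rfl⟩
  let st : Ordinal.{u} → Digraph V := fun ξ =>
    D.flip (oddSet (fun j => symmHull (C j)) {i | Ordinal.typein r i < ξ})
  have hst : ∀ ξ, (st ξ).IsTournament := fun ξ =>
    hD.flip (isSymmSet_oddSet _ fun _ => isSymmSet_symmHull _)
  have main : ∀ ξ ≤ α, D.ReversesTo C' ξ (st ξ) := by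
    intro ξ
    induction ξ using Ordinal.limitRecOn with
    | zero =>
      intro _
      have : st 0 = D := by simp [st]
      rw [this]
      exact .empty
    | add_one ξ ih =>
      intro hξ
      rw [← Order.succ_eq_add_one] at hξ ⊢
      rw [Order.succ_le_iff] at hξ
      obtain ⟨i, hi⟩ := Ordinal.typein_surj r (hα ▸ hξ)
      have hcyc : (st ξ).IsDirectedCycle (C' ξ) := by
        rw [← hi, hC']
        simpa [st, Ordinal.typein_lt_typein] using h2 i
      have e : st (Order.succ ξ) = (st ξ).reverse (C' ξ) := by
        have := oddSet_insert (N := fun j => symmHull (C j))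
          (I := {j | Ordinal.typein r j < Ordinal.typein r i}) (i := i)
          (by rw [Set.mem_ofPred_eq]; exact lt_irrefl _)
          fun p => (h1 p).subset fun _ h => h.2
        have e2 : {j | Ordinal.typein r j < Order.succ (Ordinal.typein r i)} =
            insert i {j | Ordinal.typein r j < Ordinal.typein r i} := by
          ext j
          rw [Set.mem_insert_iff, Set.mem_ofPred_eq, Set.mem_ofPred_eq, Order.lt_succ_iff,
            le_iff_eq_or_lt, Ordinal.typein_inj]
        rw [reverse_eq_flip (hst ξ) hcyc, flip_flip (isSymmSet_oddSet _ fun _ =>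
          isSymmSet_symmHull _), ← hi, hC', ← this, ← e2]
      rw [e]
      exact .snoc _ _ (ih hξ.le) hcyc
    | limit l hl ih =>
      intro hlα
      -- Only finitely many cycles contain a given pair, so below the limit `l` its orientation is
      -- eventually constant and equals the one given by its total parity.
      have e : limitBelow st l = st l := by
        have key : ∀ a b, ∃ m < l, ∀ ξ, m < ξ → ξ ≤ l →
            ((st ξ).Adj a b ↔ (st l).Adj a b) := by
          intro a b
          have hbd : ∀ s : Set ι, s.Finite → ∃ m < l, ∀ i ∈ s, Ordinal.typein r i < l →
              Ordinal.typein r i ≤ m := by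
            intro s hs
            induction s, hs using Set.Finite.induction_on with
            | empty => exact ⟨0, hl.bot_lt, by simp⟩
            | @insert i s _ _ ih' =>
              obtain ⟨m, hm, hms⟩ := ih'
              by_cases hi : Ordinal.typein r i < l
              · refine ⟨max m (Ordinal.typein r i), max_lt hm hi, ?_⟩
                rintro j (rfl | hj) hjl
                · exact le_max_right _ _
                · exact (hms j hj hjl).trans (le_max_left _ _)
              · refine ⟨m, hm, ?_⟩
                rintro j (rfl | hj) hjl
                · exact absurd hjl hi
                · exact hms j hj hjl
          obtain ⟨m, hm, hms⟩ := hbd _ (h1 (a, b))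
          refine ⟨m, hm, fun ξ hξ hξl => ?_⟩
          have : (a, b) ∈ oddSet (fun j => symmHull (C j)) {i | Ordinal.typein r i < ξ} ↔
              (a, b) ∈ oddSet (fun j => symmHull (C j)) {i | Ordinal.typein r i < l} := by
            have : {i | i ∈ {i | Ordinal.typein r i < ξ} ∧ (a, b) ∈ symmHull (C i)} =
                {i | i ∈ {i | Ordinal.typein r i < l} ∧ (a, b) ∈ symmHull (C i)} := by
              ext i
              simp only [Set.mem_ofPred_eq]
              exact ⟨fun h => ⟨h.1.trans_le hξl, h.2⟩,
                fun h => ⟨(hms i h.2 h.1).trans_lt hξ, h.2⟩⟩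
            simp only [oddSet, Set.mem_ofPred_eq] at this ⊢
            rw [this]
          simp [st, flip, this]
        ext a b
        obtain ⟨m, hm, hmξ⟩ := key a b
        constructor
        · rintro ⟨m', hm', h⟩
          have h1 := hl.succ_lt (max_lt hm hm')
          have h2 := Order.lt_succ (max m m')
          exact (hmξ _ ((le_max_left _ _).trans_lt h2) h1.le).1
            (h _ ((le_max_right _ _).trans_lt h2) h1)
        · exact fun h => ⟨m, hm, fun ξ h1 h2 => (hmξ ξ h1 h2.le).2 h⟩
      rw [← e]
      exact .limit l st hl (fun ξ hξ => ih ξ hξ (hξ.le.trans hlα)) (hlf l)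
  refine ⟨α, C', hlf α, ?_⟩
  have : st α = D.flip (oddSet (fun j => symmHull (C j)) Set.univ) := by
    simp only [st, hα, Ordinal.typein_lt_type, Set.ofPred_true]
  rw [← this]
  exact main α le_rfl

theorem Breakable.exists_reversesTo {D : Digraph V} (hD : D.IsTournament)
    (h : Breakable Cardinal.aleph0 D) :
    ∃ (α : Ordinal.{u}) (C : Ordinal.{u} → Set (V × V)) (D' : Digraph V),
      LocallyFiniteBelow C α ∧ D.ReversesTo C α D' ∧
        ∀ S : Set V, D'.IsStrongComponent S → S.Finite := by
  obtain ⟨N, hN, hfin⟩ := h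
  obtain ⟨α, C, h1, h2⟩ := hN.exists_reversesTo hD
  refine ⟨α, C, _, h1, h2, fun S hS => ?_⟩
  rcases S.eq_empty_or_nonempty with rfl | ⟨a, ha⟩
  · exact Set.finite_empty
  · exact (Cardinal.lt_aleph0_iff_set_finite.1 (hfin a)).subset (hS.prop.subset_comp ha)

/-! ### Finite circulations -/

/-- The divergence (outflow minus inflow) of a finite set of arcs. -/
noncomputable def divergence (N : Finset (V × V)) : V →₀ ℤ :=
  ∑ e ∈ N, (Finsupp.single e.1 1 - Finsupp.single e.2 1)

/-- If no arc of `N` left `b`, every arc would contribute at most 0 to the divergence at `b`, and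
the arc from `a` would contribute -1. -/
theorem exists_next {N : Finset (V × V)} (hN : divergence N = 0) {a b : V} (hab : (a, b) ∈ N) :
    ∃ c, (b, c) ∈ N := by
  classical
  by_contra! h
  have h0 : ∑ e ∈ N, ((Finsupp.single e.1 1 - Finsupp.single e.2 1 : V →₀ ℤ) b) = 0 := by
    rw [← Finsupp.finsetSum_apply]
    exact DFunLike.congr_fun hN b
  have hle : ∀ e ∈ N, ((Finsupp.single e.1 1 - Finsupp.single e.2 1 : V →₀ ℤ) b) ≤ 0 := by
    rintro ⟨c, d⟩ he
    have hc : c ≠ b := by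
      rintro rfl
      exact h _ he
    by_cases hd : d = b <;> simp [hc, hd]
  have hlt : ∑ e ∈ N, ((Finsupp.single e.1 1 - Finsupp.single e.2 1 : V →₀ ℤ) b) < ∑ e ∈ N, 0 := by
    refine Finset.sum_lt_sum hle ⟨_, hab, ?_⟩
    have hc : a ≠ b := by
      rintro rfl
      exact h _ hab
    simp [hc]
  rw [h0, Finset.sum_const_zero] at hlt
  exact lt_irrefl _ hlt

/-- A nonempty finite set of arcs without divergence contains a directed cycle. -/
theorem exists_cycle {G : Digraph V} (hG : G.IsTournament) {N : Finset (V × V)}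
    (hN : divergence N = 0) (hNG : ∀ a b, (a, b) ∈ N → G.Adj a b) (hne : N.Nonempty) :
    ∃ C : Finset (V × V), C ⊆ N ∧ C.Nonempty ∧ divergence C = 0 ∧
      G.IsDirectedCycle (C : Set (V × V)) := by
  classical
  obtain ⟨⟨a, b⟩, hab⟩ := hne
  -- The choice function `f` obtained from this follows an arc of `N` from every head of such an
  -- arc; its value elsewhere is irrelevant.
  have hex : ∀ b, ∃ c, (∃ a, (a, b) ∈ N) → (b, c) ∈ N := by
    intro b
    by_cases h : ∃ a, (a, b) ∈ N
    · obtain ⟨a, ha⟩ := h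
      obtain ⟨c, hc⟩ := exists_next hN ha
      exact ⟨c, fun _ => hc⟩
    · exact ⟨b, fun h' => absurd h' h⟩
  choose f hf using hex
  have hmem : ∀ n, ∃ a, (a, f^[n] b) ∈ N := by
    intro n
    induction n with
    | zero => exact ⟨a, hab⟩
    | succ n ih =>
      rw [Function.iterate_succ_apply']
      exact ⟨_, hf _ ih⟩
  have hfin : (Set.range fun n => f^[n] b).Finite := by
    refine (N.image Prod.snd).finite_toSet.subset ?_
    rintro _ ⟨n, rfl⟩
    obtain ⟨a, ha⟩ := hmem n
    exact Finset.mem_coe.2 (Finset.mem_image.2 ⟨_, ha, rfl⟩)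
  obtain ⟨i, j, hij, hfij⟩ : ∃ i j, i < j ∧ f^[i] b = f^[j] b := by
    by_contra! h
    refine Set.infinite_range_of_injective (f := fun n => f^[n] b) (fun i j hij => ?_) hfin
    rcases lt_trichotomy i j with hlt | heq | hlt
    · exact absurd hij (h i j hlt)
    · exact heq
    · exact absurd hij.symm (h j i hlt)
  -- The orbit of `b` lives on finitely many vertices, so it runs into a cycle through `y`, whose
  -- length is the minimal period. Periods 1 and 2 would give a loop or an antiparallel pair.
  set y := f^[i] b with hy
  have hper : Function.IsPeriodicPt f (j - i) y := by
    rw [Function.IsPeriodicPt, Function.IsFixedPt, hy, ← Function.iterate_add_apply,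
      Nat.sub_add_cancel hij.le, ← hfij]
  set n := Function.minimalPeriod f y with hn
  have hn0 : 0 < n := hper.minimalPeriod_pos (Nat.sub_pos_of_lt hij)
  have hyN : ∀ k, (f^[k] y, f^[k + 1] y) ∈ N := by
    intro k
    rw [Function.iterate_succ_apply']
    refine hf _ ?_
    rw [hy, ← Function.iterate_add_apply]
    exact hmem _
  have hyn : f^[n] y = y := Function.iterate_minimalPeriod
  have hn3 : 3 ≤ n := by
    by_contra! hlt
    interval_cases n
    · have := hNG _ _ (hyN 0)
      rw [hyn] at this
      exact hG.1 _ this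
    · have h1 := hNG _ _ (hyN 0)
      have h2 := hNG _ _ (hyN 1)
      rw [hyn] at h2
      exact hG.asymm h1 h2
  have : NeZero n := ⟨hn0.ne'⟩
  let x : ZMod n → V := fun k => f^[k.val] y
  have hxinj : Function.Injective x := fun k l hkl =>
    ZMod.val_injective n ((Function.iterate_eq_iterate_iff_of_lt_minimalPeriod
      (ZMod.val_lt k) (ZMod.val_lt l)).1 hkl)
  have hxs : ∀ k, x (k + 1) = f^[k.val + 1] y := by
    intro k
    have h1 : (1 : ZMod n).val = 1 := ZMod.val_one'' (by omega)
    change f^[(k + 1).val] y = _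
    rw [ZMod.val_add, h1]
    exact Function.iterate_mod_minimalPeriod_eq
  have hxN : ∀ k, (x k, x (k + 1)) ∈ N := fun k => by
    rw [hxs]
    exact hyN _
  refine ⟨Finset.univ.image fun k => (x k, x (k + 1)), ?_, ?_, ?_, n, hn3, x, hxinj,
    fun k => hNG _ _ (hxN k), by simp⟩
  · exact Finset.image_subset_iff.2 fun k _ => hxN k
  · exact Finset.univ_nonempty.image _
  · rw [divergence, Finset.sum_image fun k _ l _ h => hxinj (Prod.ext_iff.1 h).1]
    simp only [Finset.sum_sub_distrib]
    rw [sub_eq_zero]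
    exact (Equiv.sum_comp (Equiv.addRight (1 : ZMod n)) fun k => Finsupp.single (x k) (1 : ℤ)).symm

theorem IsDirectedCycle.reversible {G : Digraph V} {C : Set (V × V)} (h : G.IsDirectedCycle C) :
    Reversible G (symmHull C) (symmHull C) := by
  refine ⟨PUnit, emptyRelation, inferInstance, fun _ => C, fun _ => Set.toFinite _, fun _ => ?_,
    fun _ => le_rfl, ?_⟩
  · simpa [emptyRelation] using h
  · rw [oddSet_univ_eq_iUnion fun _ _ _ _ _ => rfl]
    exact (Set.iUnion_const _).symm

theorem symmHull_union (C C' : Set (V × V)) :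
    symmHull (C ∪ C') = symmHull C ∪ symmHull C' := by
  ext p
  simp only [symmHull, Set.mem_union, Set.mem_ofPred_eq]
  tauto

theorem disjoint_symmHull {G : Digraph V} (hG : G.IsTournament) {A B : Set (V × V)}
    (hA : ∀ a b, (a, b) ∈ A → G.Adj a b) (hB : ∀ a b, (a, b) ∈ B → G.Adj a b)
    (hAB : Disjoint A B) : Disjoint (symmHull A) (symmHull B) := by
  rw [Set.disjoint_left] at hAB ⊢
  rintro ⟨a, b⟩ (h1 | h1) (h2 | h2)
  · exact hAB h1 h2
  · exact hG.asymm (hA _ _ h1) (hB _ _ h2)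
  · exact hG.asymm (hA _ _ h1) (hB _ _ h2)
  · exact hAB h1 h2

/-- A finite set of arcs without divergence can be reversed. -/
theorem reversible_of_divergence_eq_zero {G : Digraph V} (hG : G.IsTournament)
    {N : Finset (V × V)} (hN : divergence N = 0) (hNG : ∀ a b, (a, b) ∈ N → G.Adj a b) :
    Reversible G (symmHull (N : Set (V × V))) (symmHull (N : Set (V × V))) := by
  classical
  induction N using Finset.strongInduction generalizing G with
  | H N ih =>
    rcases N.eq_empty_or_nonempty with rfl | hne
    · simpa [symmHull] using reversible_empty G _
    obtain ⟨C, hCN, hCne, hC0, hC⟩ := exists_cycle hG hN hNG hne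
    -- Removing a cycle leaves a divergence-free set, which is disjoint from the cycle and so still
    -- consists of arcs after the cycle is reversed.
    have h0 : divergence (N \ C) = 0 := by
      have := Finset.sum_sdiff (f := fun e : V × V =>
        (Finsupp.single e.1 (1 : ℤ) - Finsupp.single e.2 1)) hCN
      simp only [divergence] at hC0 hN ⊢
      rwa [hC0, hN, add_zero] at this
    have hdisj : Disjoint (symmHull (C : Set (V × V))) (symmHull ((N \ C : Finset (V × V)) :
        Set (V × V))) := by
      refine disjoint_symmHull hG (fun a b h => hNG a b (hCN h))
        (fun a b h => hNG a b (Finset.sdiff_subset h)) ?_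
      exact_mod_cast Finset.disjoint_sdiff
    have h2 := ih (N \ C) (Finset.sdiff_ssubset hCN hCne)
      (G := G.flip (symmHull C)) (hG.flip (isSymmSet_symmHull _)) h0 (fun a b hab => by
        rw [flip_adj_of_notMem]
        · exact hNG a b (Finset.sdiff_subset hab)
        · exact fun h => Set.disjoint_left.1 hdisj h (Or.inl hab))
    have h3 := hC.reversible.trans h2
    rw [hdisj.symmDiff_eq_sup] at h3
    change Reversible G (_ ∪ _) _ at h3
    rwa [← symmHull_union, ← Finset.coe_union,
      Finset.union_sdiff_of_subset hCN] at h3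

theorem divergence_union {M N : Finset (V × V)} [DecidableEq (V × V)] (h : Disjoint M N) :
    divergence (M ∪ N) = divergence M + divergence N :=
  Finset.sum_union h

theorem divergence_image_swap [DecidableEq (V × V)] (N : Finset (V × V)) :
    divergence (N.image Prod.swap) = - divergence N := by
  rw [divergence, Finset.sum_image Prod.swap_injective.injOn, divergence,
    ← Finset.sum_neg_distrib]
  simp

/-! ### Pushing arcs off to infinity -/

/-- Pushing a finite set of arcs off to infinity: the arcs of `A 0` (reversed) and of all `B n` get
reversed, while the arcs of `A (n + 1)` are reversed twice. -/
theorem reversible_push {D : Digraph V} (hD : D.IsTournament) {A B : ℕ → Finset (V × V)}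
    (hA0 : ∀ a b, (a, b) ∈ A 0 → D.Adj b a) (hA : ∀ n a b, (a, b) ∈ A (n + 1) → D.Adj a b)
    (hB : ∀ n a b, (a, b) ∈ B n → D.Adj a b)
    (hAA : ∀ m n p, p ∈ symmHull (A m : Set (V × V)) → p ∈ symmHull (A n : Set (V × V)) → m = n)
    (hBB : ∀ m n p, p ∈ symmHull (B m : Set (V × V)) → p ∈ symmHull (B n : Set (V × V)) → m = n)
    (hAB : ∀ m n p, p ∈ symmHull (A m : Set (V × V)) → p ∉ symmHull (B n : Set (V × V)))
    (hdiv : ∀ n, divergence (B n) + divergence (A (n + 1)) = divergence (A n)) :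
    Reversible D (symmHull ((A 0 : Set (V × V)) ∪ ⋃ n, B n))
      (symmHull ((⋃ n, (A n : Set (V × V))) ∪ ⋃ n, B n)) := by
  classical
  -- Before block `n` the pairs of `A n` are oriented backwards. Together with `B n` and `A (n + 1)`
  -- they form a divergence-free set by `hdiv`; reversing it turns `A n` forward and leaves `A (n +
  -- 1)` backward for the next block.
  let N : ℕ → Set (V × V) := fun n => symmHull (A n) ∪ symmHull (B n) ∪ symmHull (A (n + 1))
  let G : ℕ → Digraph V := fun n => Nat.rec D (fun n H => H.flip (N n)) n
  have hGs : ∀ n, G (n + 1) = (G n).flip (N n) := fun n => rfl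
  have hNsymm : ∀ n, IsSymmSet (N n) := by
    intro n
    simp only [N, ← symmHull_union]
    exact isSymmSet_symmHull _
  have hGT : ∀ n, (G n).IsTournament := by
    intro n
    induction n with
    | zero => exact hD
    | succ n ih => exact ih.flip (hNsymm n)
  have hmem : ∀ {C : Finset (V × V)} {a b : V}, (a, b) ∈ C → (a, b) ∈ symmHull (C : Set (V × V)) :=
    fun h => Or.inl h
  have state : ∀ n, (∀ a b, (a, b) ∈ A n → (G n).Adj b a) ∧
      (∀ m a b, n < m → (a, b) ∈ A m → (G n).Adj a b) ∧
      (∀ m a b, n ≤ m → (a, b) ∈ B m → (G n).Adj a b) := by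
    intro n
    induction n with
    | zero =>
      refine ⟨hA0, fun m a b hm h => ?_, fun m a b _ h => hB m a b h⟩
      obtain ⟨m, rfl⟩ := Nat.exists_eq_succ_of_ne_zero hm.ne'
      exact hA m a b h
    | succ n ih =>
      obtain ⟨-, ih2, ih3⟩ := ih
      refine ⟨fun a b h => ?_, fun m a b hm h => ?_, fun m a b hm h => ?_⟩
      · rw [hGs, flip_adj_of_mem]
        · exact ih2 _ _ _ (Nat.lt_succ_self n) h
        · exact hNsymm n _ _ (Or.inr (hmem h))
      · rw [hGs, flip_adj_of_notMem]
        · exact ih2 _ _ _ (by omega) h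
        · rintro ((h' | h') | h')
          · have := hAA _ _ _ (hmem h) h'
            omega
          · exact hAB _ _ _ (hmem h) h'
          · have := hAA _ _ _ (hmem h) h'
            omega
      · rw [hGs, flip_adj_of_notMem]
        · exact ih3 _ _ _ (by omega) h
        · rintro ((h' | h') | h')
          · exact hAB _ _ _ h' (hmem h)
          · have := hBB _ _ _ (hmem h) h'
            omega
          · exact hAB _ _ _ h' (hmem h)
  have hstep : ∀ n, Reversible (G n) (N n) (N n) := by
    intro n
    obtain ⟨s1, s2, s3⟩ := state n
    have d1 : Disjoint ((A n).image Prod.swap) (B n) := by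
      rw [Finset.disjoint_left]
      rintro ⟨a, b⟩ h1 h2
      obtain ⟨⟨c, d⟩, h3, e⟩ := Finset.mem_image.1 h1
      cases e
      exact hAB _ _ _ (isSymmSet_symmHull _ _ _ (hmem h3)) (hmem h2)
    have d2 : Disjoint ((A n).image Prod.swap ∪ B n) (A (n + 1)) := by
      rw [Finset.disjoint_left]
      rintro ⟨a, b⟩ h1 h2
      rcases Finset.mem_union.1 h1 with h1 | h1
      · obtain ⟨⟨c, d⟩, h3, e⟩ := Finset.mem_image.1 h1
        cases e
        have := hAA _ _ _ (isSymmSet_symmHull _ _ _ (hmem h3)) (hmem h2)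
        omega
      · exact hAB _ _ _ (hmem h2) (hmem h1)
    have hrev := reversible_of_divergence_eq_zero (hGT n)
      (N := (A n).image Prod.swap ∪ B n ∪ A (n + 1))
      (by rw [divergence_union d2, divergence_union d1, divergence_image_swap, add_assoc, hdiv,
            neg_add_cancel])
      (by
        intro a b h
        rcases Finset.mem_union.1 h with h | h
        · rcases Finset.mem_union.1 h with h | h
          · obtain ⟨⟨c, d⟩, h1, e⟩ := Finset.mem_image.1 h
            cases e
            exact s1 _ _ h1
          · exact s3 _ _ _ le_rfl h
        · exact s2 _ _ _ (Nat.lt_succ_self n) h)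
    rwa [Finset.coe_union, Finset.coe_union, symmHull_union, symmHull_union, Finset.coe_image,
      symmHull_image_swap] at hrev
  -- A pair of `A m` occurs in the blocks `m - 1` and `m`, hence twice unless `m = 0`; a pair of `B
  -- m` occurs only in block `m`.
  have hcount : ∀ p, {n | p ∈ N n}.Finite ∧ (Odd {n | p ∈ N n}.ncard ↔
      p ∈ symmHull ((A 0 : Set (V × V)) ∪ ⋃ n, B n)) := by
    intro p
    rw [symmHull_union, symmHull_iUnion]
    by_cases h1 : ∃ m, p ∈ symmHull (A m : Set (V × V))
    · obtain ⟨m, hm⟩ := h1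
      have e : ∀ n, p ∈ N n ↔ n = m ∨ n + 1 = m := by
        intro n
        constructor
        · rintro ((h | h) | h)
          · exact Or.inl (hAA _ _ _ h hm)
          · exact absurd h (hAB _ _ _ hm)
          · exact Or.inr (hAA _ _ _ h hm)
        · rintro (rfl | rfl)
          · exact Or.inl (Or.inl hm)
          · exact Or.inr hm
      have hnB : ∀ n, p ∉ symmHull (B n : Set (V × V)) := fun n => hAB _ _ _ hm
      rcases m with _ | m
      · have : {n | p ∈ N n} = {0} := by
          ext n
          simp [e]
        simp [this, hm]
      · have h2 : {n | p ∈ N n} = {m + 1, m} := by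
          ext n
          simp [e]
        have h3 : p ∉ symmHull (A 0 : Set (V × V)) := fun h => by
          have := hAA _ _ _ hm h
          omega
        rw [h2, Set.ncard_pair (by omega)]
        refine ⟨Set.toFinite _, ?_⟩
        simp [h3, hnB]
    · push Not at h1
      by_cases h2 : ∃ m, p ∈ symmHull (B m : Set (V × V))
      · obtain ⟨m, hm⟩ := h2
        have : {n | p ∈ N n} = {m} := by
          ext n
          constructor
          · rintro ((h | h) | h)
            · exact absurd h (h1 _)
            · exact hBB _ _ _ h hm
            · exact absurd h (h1 _)
          · rintro rfl
            exact Or.inl (Or.inr hm)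
        rw [this]
        refine ⟨Set.toFinite _, ?_⟩
        simp only [Set.ncard_singleton, odd_one, true_iff]
        exact Or.inr (Set.mem_iUnion.2 ⟨m, hm⟩)
      · push Not at h2
        have : {n | p ∈ N n} = ∅ := by
          ext n
          simp [N, h1, h2]
        rw [this]
        refine ⟨Set.toFinite _, ?_⟩
        simp [h1, h2]
  have key := (Reversible.concat_nat hstep hGs fun p => (hcount p).1).1
  have e : oddSet N Set.univ = symmHull ((A 0 : Set (V × V)) ∪ ⋃ n, B n) := by
    ext p
    simp only [oddSet, Set.mem_univ, true_and, Set.mem_ofPred_eq]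
    exact (hcount p).2
  rw [e] at key
  refine key.mono (Set.iUnion_subset fun n => ?_)
  simp only [N, symmHull_union, symmHull_iUnion]
  refine Set.union_subset (Set.union_subset ?_ ?_) ?_
  · exact (Set.subset_iUnion (fun n => symmHull (A n : Set (V × V))) n).trans
      Set.subset_union_left
  · exact (Set.subset_iUnion (fun n => symmHull (B n : Set (V × V))) n).trans
      Set.subset_union_right
  · exact (Set.subset_iUnion (fun n => symmHull (A n : Set (V × V))) (n + 1)).trans
      Set.subset_union_left

/-! ### Flipping many arcs simultaneously -/

open Cardinal

/-- Order by `c` first, and embed each level `c = κ` into the initial ordinal of `κ`. Below `e` lie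
fewer than `c e` elements of smaller levels and a proper initial segment of its own level. -/
theorem exists_wellOrder_mk_lt {E : Type u} {c : E → Cardinal.{u}} (hc : ∀ e, ℵ₀ ≤ c e)
    (h1 : ∀ e, #{e' // c e' ≤ c e} ≤ c e) (h2 : ∀ e, #{e' // c e' < c e} < c e) :
    ∃ r : E → E → Prop, IsWellOrder E r ∧ ∀ e, #{e' // r e' e} < c e := by
  have hf : ∀ κ : Cardinal.{u}, ∃ f : {e // c e = κ} → κ.ord.ToType, Function.Injective f := by
    intro κ
    have : #{e // c e = κ} ≤ #(κ.ord.ToType) := by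
      rw [mk_ord_toType]
      by_cases h : ∃ e, c e = κ
      · obtain ⟨e, rfl⟩ := h
        exact (mk_subtype_mono fun e' h => h.le).trans (h1 e)
      · push Not at h
        have : IsEmpty {e // c e = κ} := ⟨fun e => h _ e.2⟩
        simp
    obtain ⟨f⟩ := this
    exact ⟨f, f.injective⟩
  choose f hf using hf
  let idx : E → Ordinal.{u} := fun e =>
    Ordinal.typein (α := (c e).ord.ToType) (· < ·) (f (c e) ⟨e, rfl⟩)
  have hidx : ∀ κ e (h : c e = κ),
      idx e = Ordinal.typein (α := κ.ord.ToType) (· < ·) (f κ ⟨e, h⟩) := by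
    rintro κ e rfl
    rfl
  let g : E → Cardinal.{u} ×ₗ Ordinal.{u} := fun e => toLex (c e, idx e)
  have hg : Function.Injective g := by
    intro e e' h
    have h3 : c e = c e' := congrArg (fun x => (ofLex x).1) h
    have h4 : idx e = idx e' := congrArg (fun x => (ofLex x).2) h
    rw [hidx _ e h3, hidx _ e' rfl, Ordinal.typein_inj] at h4
    exact congrArg Subtype.val (hf _ h4)
  refine ⟨fun e e' => g e < g e', ?_, fun e => ?_⟩
  · exact { wf := InvImage.wf g wellFounded_lt
            trichotomous := fun a b h h' => hg (le_antisymm (not_lt.1 h') (not_lt.1 h)) }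
  · have hsub : {e' | g e' < g e} ⊆ {e' | c e' < c e} ∪ {e' | c e' = c e ∧ idx e' < idx e} := by
      intro e' h
      simpa [g, Prod.Lex.toLex_lt_toLex] using h
    refine (mk_le_mk_of_subset hsub).trans_lt ((mk_union_le _ _).trans_lt
      (add_lt_of_lt (hc e) (h2 e) ?_))
    refine lt_of_le_of_lt ?_ (mk_Iio_lt (f (c e) ⟨e, rfl⟩) ?_ |>.trans_eq (mk_ord_toType _))
    refine mk_le_of_injective (f := fun x => ⟨f (c e) ⟨x.1, x.2.1⟩, ?_⟩) ?_
    · exact (Ordinal.typein_lt_typein (α := (c e).ord.ToType) (· < ·)).1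
        ((hidx _ _ x.2.1).symm.trans_lt (x.2.2.trans_eq (hidx _ e rfl)))
    · intro x y hxy
      have := hf _ (congrArg Subtype.val hxy)
      exact Subtype.ext (Subtype.mk.inj this)
    · simp

/-- Regularity of `κ` is not needed because the pieces are finite. -/
theorem mk_iUnion_finset_lt {ι α : Type u} {κ : Cardinal.{u}} (hκ : ℵ₀ ≤ κ) (hι : #ι < κ)
    (P : ι → Finset α) : #(⋃ i, (P i : Set α)) < κ := by
  rcases hκ.eq_or_lt with rfl | hκ
  · have : Finite ι := lt_aleph0_iff_finite.1 hι
    exact lt_aleph0_iff_set_finite.2 (Set.finite_iUnion fun i => (P i).finite_toSet)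
  · refine (mk_iUnion_le_sum_mk.trans (sum_le_sum _ (fun _ => ℵ₀) fun i => ?_)).trans_lt ?_
    · exact (lt_aleph0_iff_set_finite.2 (P i).finite_toSet).le
    · rw [sum_const']
      exact mul_lt_of_lt hκ.le hι hκ

/-- A path from `u` to `v` contains a finite set of arcs carrying a unit flow from `u` to `v`. -/
theorem exists_unit_flow {R : V → V → Prop} {u v : V} (h : Relation.ReflTransGen R u v) :
    ∃ P : Finset (V × V), (∀ a b, (a, b) ∈ P → R a b) ∧
      divergence P = Finsupp.single u 1 - Finsupp.single v 1 := by
  classical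
  have hex : ∃ n, ∃ p : ℕ → V, p 0 = u ∧ p n = v ∧ ∀ i < n, R (p i) (p (i + 1)) := by
    induction h with
    | refl => exact ⟨0, fun _ => u, rfl, rfl, by simp⟩
    | @tail b c _ hbc ih =>
      obtain ⟨n, p, h0, hn, hp⟩ := ih
      refine ⟨n + 1, fun k => if k ≤ n then p k else c, by simpa, by simp, fun i hi => ?_⟩
      rcases (Nat.lt_succ_iff.1 hi).eq_or_lt with rfl | hi'
      · simpa [hn]
      · simpa [hi'.le, Nat.succ_le_of_lt hi'] using hp i hi'
  obtain ⟨p, h0, hn, hp⟩ := Nat.find_spec hex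
  set n := Nat.find hex with hn_def
  -- In a shortest walk the arcs have distinct tails, since a repetition could be cut out. So each
  -- arc is counted once in the `Finset`, and the divergence telescopes.
  have hinj : ∀ i j, i < j → j < n → p i ≠ p j := by
    intro i j hij hjn heq
    refine Nat.find_min hex (m := n - (j - i)) (by omega)
      ⟨fun k => if k ≤ i then p k else p (k + (j - i)), by simpa, ?_, fun k hk => ?_⟩
    · have h1 : ¬ (n - (j - i) ≤ i) := by omega
      have h2 : n - (j - i) + (j - i) = n := by omega
      simp only [h1, if_false, h2, hn]
    · rcases lt_trichotomy k i with hki | rfl | hki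
      · simpa [hki.le, Nat.succ_le_of_lt hki] using hp k (by omega)
      · have h2 : k + 1 + (j - k) = j + 1 := by omega
        simpa [h2, heq] using hp j hjn
      · have h1 : ¬ (k ≤ i) := by omega
        have h2 : ¬ (k + 1 ≤ i) := by omega
        have h3 : k + 1 + (j - i) = k + (j - i) + 1 := by omega
        simp only [h1, h2, if_false, h3]
        exact hp _ (by omega)
  refine ⟨(Finset.range n).image fun i => (p i, p (i + 1)), ?_, ?_⟩
  · intro a b hab
    obtain ⟨i, hi, e⟩ := Finset.mem_image.1 hab
    cases e
    exact hp i (Finset.mem_range.1 hi)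
  · rw [divergence, Finset.sum_image]
    · rw [← h0, ← hn]
      exact Finset.sum_range_sub' (fun i => Finsupp.single (p i) (1 : ℤ)) n
    · intro i hi j hj hij
      have hi' := Finset.mem_range.1 (Finset.mem_coe.1 hi)
      have hj' := Finset.mem_range.1 (Finset.mem_coe.1 hj)
      have hpij : p i = p j := (Prod.ext_iff.1 hij).1
      rcases lt_trichotomy i j with hlt | heq | hlt
      · exact absurd hpij (hinj i j hlt hj')
      · exact heq
      · exact absurd hpij.symm (hinj j i hlt hi')

theorem divergence_singleton (e : V × V) :
    divergence {e} = Finsupp.single e.1 1 - Finsupp.single e.2 1 :=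
  Finset.sum_singleton _ _

/-- Simultaneous flipping of a set `E` of arcs, where each arc `e` in `E` can be bypassed in at
least `c e` many ways. -/
theorem reversible_flip {D : Digraph V} (hD : D.IsTournament) {E : Set (V × V)}
    (hE : ∀ a b, (a, b) ∈ E → D.Adj a b) {c : E → Cardinal.{u}} (hc : ∀ e, ℵ₀ ≤ c e)
    (h1 : ∀ e, #{e' // c e' ≤ c e} ≤ c e) (h2 : ∀ e, #{e' // c e' < c e} < c e)
    (hpath : ∀ (e : E) (Z : Set (V × V)), #Z < c e →
      Relation.ReflTransGen (fun x y => D.Adj x y ∧ (x, y) ∉ Z) e.1.2 e.1.1) :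
    Reversible D (symmHull E) Set.univ := by
  classical
  obtain ⟨r, hr, hrc⟩ := exists_wellOrder_mk_lt hc h1 h2
  -- Two orders are in play: `r` is the order in which the arcs are flipped, `s` the order in which
  -- the countably many return paths of every arc are chosen.
  obtain ⟨s, hs, hsc⟩ := exists_wellOrder_mk_lt (E := E × ULift.{u} ℕ) (c := fun p => c p.1)
    (fun p => hc p.1) (fun p => by
      have e : #{q : E × ULift.{u} ℕ // c q.1 ≤ c p.1} ≤ #({e' // c e' ≤ c p.1} × ULift.{u} ℕ) :=
        mk_le_of_injective (f := fun q => (⟨q.1.1, q.2⟩, q.1.2)) fun q q' h => by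
          simp only [Prod.mk.injEq, Subtype.mk.injEq] at h
          exact Subtype.ext (Prod.ext h.1 h.2)
      refine e.trans ?_
      rw [mk_prod, lift_id, lift_id, mk_uLift, mk_nat, lift_aleph0]
      exact mul_le_of_le (hc _) (h1 _) (hc _)) (fun p => by
      have e : #{q : E × ULift.{u} ℕ // c q.1 < c p.1} ≤ #({e' // c e' < c p.1} × ULift.{u} ℕ) :=
        mk_le_of_injective (f := fun q => (⟨q.1.1, q.2⟩, q.1.2)) fun q q' h => by
          simp only [Prod.mk.injEq, Subtype.mk.injEq] at h
          exact Subtype.ext (Prod.ext h.1 h.2)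
      refine e.trans_lt ?_
      rcases (hc p.1).eq_or_lt with h | h
      · have : IsEmpty {e' // c e' < c p.1} := ⟨fun e' => (e'.2.trans_eq h.symm).not_ge (hc e'.1)⟩
        rw [mk_eq_zero]
        exact aleph0_pos.trans_le (hc _)
      · rw [mk_prod, lift_id, lift_id, mk_uLift, mk_nat, lift_aleph0]
        exact mul_lt_of_lt (hc _) (h2 _) h)
  -- Forbidden for the path with index `p`: all paths chosen before, the arc itself, and the arcs of
  -- `E` flipped before it. Arcs of `E` flipped later are allowed, as they still have their original
  -- direction and are restored by the push.
  let Z : ∀ p : E × ULift.{u} ℕ, (∀ q, s q p → Finset (V × V)) → Set (V × V) := fun p prev =>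
    (⋃ q : {q // s q p}, (prev q.1 q.2 : Set (V × V))) ∪
      {a | ∃ e : E, (r e p.1 ∨ e = p.1) ∧ e.1 = a}
  have hZ : ∀ p prev, #(Z p prev) < c p.1 := by
    intro p prev
    refine (mk_union_le _ _).trans_lt (add_lt_of_lt (hc _)
      (mk_iUnion_finset_lt (hc _) (hsc p) _) ?_)
    have : {a | ∃ e : E, (r e p.1 ∨ e = p.1) ∧ e.1 = a} ⊆
        Subtype.val '' ({e | r e p.1} ∪ {p.1}) := by
      rintro _ ⟨e, he, rfl⟩
      exact ⟨e, he, rfl⟩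
    refine (mk_le_mk_of_subset this).trans_lt (mk_image_le.trans_lt
      ((mk_union_le _ _).trans_lt (add_lt_of_lt (hc _) (hrc p.1) ?_)))
    rw [mk_singleton]
    exact one_lt_aleph0.trans_le (hc _)
  have hex : ∀ p prev, ∃ P : Finset (V × V), (∀ a b, (a, b) ∈ P → D.Adj a b ∧
      (a, b) ∉ Z p prev) ∧ divergence P = Finsupp.single p.1.1.2 1 - Finsupp.single p.1.1.1 1 :=
    fun p prev => exists_unit_flow (hpath p.1 _ (hZ p prev))
  choose F hF hFdiv using hex
  let P : E × ULift.{u} ℕ → Finset (V × V) := hs.wf.fix F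
  have hP : ∀ p, P p = F p fun q _ => P q := fun p => hs.wf.fix_eq F p
  have hPadj : ∀ p a b, (a, b) ∈ P p → D.Adj a b := fun p a b h => by
    rw [hP] at h
    exact (hF _ _ _ _ h).1
  have hPs : ∀ p q a, s q p → a ∈ P q → a ∉ P p := fun p q a hqp h h' => by
    rw [hP p] at h'
    exact (hF _ _ a.1 a.2 h').2 (Or.inl (Set.mem_iUnion.2 ⟨⟨q, hqp⟩, h⟩))
  have hPE : ∀ p (e : E), r e p.1 ∨ e = p.1 → e.1 ∉ P p := fun p e he h => by
    rw [hP p] at h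
    exact (hF _ _ e.1.1 e.1.2 h).2 (Or.inr ⟨e, he, rfl⟩)
  have hPP : ∀ p q a, a ∈ P p → a ∈ P q → p = q := by
    intro p q a hp hq
    by_contra hne
    rcases trichotomous_of s p q with h | h | h
    · exact hPs _ _ _ h hp hq
    · exact hne h
    · exact hPs _ _ _ h hq hp
  have hPP' : ∀ p q a, a ∈ symmHull (P p : Set (V × V)) → a ∈ symmHull (P q : Set (V × V)) →
      p = q := by
    intro p q a hp hq
    by_contra hne
    refine Set.disjoint_left.1 (disjoint_symmHull hD (hPadj p) (hPadj q) ?_) hp hq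
    exact Set.disjoint_left.2 fun a h h' => hne (hPP _ _ a h h')
  have hPE' : ∀ p (e : E) a, r e p.1 ∨ e = p.1 → a ∈ symmHull {e.1} →
      a ∉ symmHull (P p : Set (V × V)) := by
    intro p e a he ha
    refine Set.disjoint_left.1 (disjoint_symmHull hD ?_ (hPadj p) ?_) ha
    · rintro a b h
      exact hE a b (h ▸ e.2)
    · exact Set.disjoint_singleton_left.2 (hPE p e he)
  have hEE : ∀ (e e' : E) a, a ∈ symmHull {e.1} → a ∈ symmHull {e'.1} → e = e' := by
    intro e e' a h h'
    by_contra hne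
    refine Set.disjoint_left.1 (disjoint_symmHull hD ?_ ?_ ?_) h h'
    · rintro a b h
      exact hE a b (h ▸ e.2)
    · rintro a b h
      exact hE a b (h ▸ e'.2)
    · exact Set.disjoint_singleton.2 fun h => hne (Subtype.ext h)
  let T : E → Set (V × V) := fun e =>
    symmHull {e.1} ∪ ⋃ n : ℕ, symmHull (P (e, ULift.up n) : Set (V × V))
  have key := Reversible.concat (D := D) r (N := fun e : E => symmHull {e.1}) (T := T)
    (fun e => ?_) (fun a => ?_)
  · rw [oddSet_univ_eq_iUnion hEE, ← symmHull_iUnion] at key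
    have : ⋃ e : E, {e.1} = E := by simp
    rw [this] at key
    exact key.mono (Set.subset_univ _)
  · have hodd := oddSet_eq_biUnion {e' | r e' e} hEE
    have hGT : (D.flip (oddSet (fun e : E => symmHull {e.1}) {e' | r e' e})).IsTournament :=
      hD.flip (isSymmSet_oddSet _ fun _ => isSymmSet_symmHull _)
    have hnot : ∀ n a, a ∈ P (e, n) →
        a ∉ oddSet (fun e : E => symmHull {e.1}) {e' | r e' e} := by
      intro n a ha h
      rw [hodd] at h
      obtain ⟨e', he', ha'⟩ := Set.mem_iUnion₂.1 h
      exact hPE' (e, n) e' a (Or.inl he') ha' (Or.inl ha)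
    have hnot' : e.1 ∉ oddSet (fun e : E => symmHull {e.1}) {e' | r e' e} := by
      intro h
      rw [hodd] at h
      obtain ⟨e', he', ha'⟩ := Set.mem_iUnion₂.1 h
      have := hEE e e' e.1 (Or.inl rfl) ha'
      subst this
      exact irrefl_of r _ he'
    have hull : symmHull {e.1.swap} = symmHull {e.1} := by
      rw [← Set.image_singleton, symmHull_image_swap]
    -- All these sets carry a unit flow from the head of `e` to its tail, so the push needs no `B`;
    -- its net effect is to flip `e` alone.
    let A : ℕ → Finset (V × V) := fun n =>
      match n with
      | 0 => {e.1.swap}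
      | n + 1 => P (e, ULift.up n)
    have hpush := reversible_push hGT (A := A) (B := fun _ => ∅) ?_ ?_ ?_ ?_ ?_ ?_ ?_
    · have h3 : (A 0 : Set (V × V)) ∪ ⋃ n : ℕ, ((∅ : Finset (V × V)) : Set (V × V)) =
          {e.1.swap} := by
        simp [A]
      rw [h3, hull] at hpush
      refine hpush.mono ?_
      rw [symmHull_union, symmHull_iUnion]
      refine Set.union_subset (Set.iUnion_subset fun n => ?_) (by simp [symmHull])
      rcases n with _ | n
      · simp only [A, Finset.coe_singleton, hull]
        exact Set.subset_union_left
      · exact (Set.subset_iUnion (fun n : ℕ => symmHull (P (e, ULift.up n) : Set (V × V))) n).trans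
          Set.subset_union_right
    · intro a b h
      obtain ⟨rfl, rfl⟩ : a = e.1.2 ∧ b = e.1.1 := by simpa [A, Prod.ext_iff] using h
      rw [flip_adj_of_notMem hnot']
      exact hE _ _ e.2
    · intro n a b h
      rw [flip_adj_of_notMem (hnot _ _ h)]
      exact hPadj _ _ _ h
    · simp
    · intro m n a hm hn
      rcases m with _ | m <;> rcases n with _ | n
      · rfl
      · simp only [A, Finset.coe_singleton, hull] at hm
        exact absurd hn (hPE' (e, _) e a (Or.inr rfl) hm)
      · simp only [A, Finset.coe_singleton, hull] at hn
        exact absurd hm (hPE' (e, _) e a (Or.inr rfl) hn)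
      · have := hPP' _ _ _ hm hn
        simpa using this
    · simp [symmHull]
    · simp [symmHull]
    · intro n
      have hA : ∀ n, divergence (A n) = Finsupp.single e.1.2 1 - Finsupp.single e.1.1 1 := by
        intro n
        match n with
        | 0 => exact divergence_singleton _
        | n + 1 =>
          change divergence (P (e, ULift.up n)) = _
          rw [hP]
          exact hFdiv _ _
      rw [divergence, Finset.sum_empty, zero_add]
      exact (hA (n + 1)).trans (hA n).symm
  · have hsub : {e | a ∈ T e} ⊆ {e | a ∈ symmHull {e.1}} ∪
        {e | ∃ n, a ∈ symmHull (P (e, n) : Set (V × V))} := by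
      rintro e (h | h)
      · exact Or.inl h
      · obtain ⟨n, hn⟩ := Set.mem_iUnion.1 h
        exact Or.inr ⟨_, hn⟩
    refine Set.Finite.subset (Set.Finite.union ?_ ?_) hsub
    · exact Set.Subsingleton.finite fun e he e' he' => hEE e e' a he he'
    · refine Set.Subsingleton.finite ?_
      rintro e ⟨n, he⟩ e' ⟨n', he'⟩
      exact congrArg Prod.fst (hPP' _ _ a he he')

/-! ### Small cuts, linkage and barriers -/

/-- The arcs of `D` leaving `X`. -/
def outArcs (D : Digraph V) (X : Set V) : Set (V × V) :=
  {p | p.1 ∈ X ∧ p.2 ∉ X ∧ D.Adj p.1 p.2}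

/-- Fewer than `κ` arcs leave `X`, every vertex outside `X` has fewer than `κ` out-neighbours
outside `X`, and every vertex in `X` has fewer than `κ` in-neighbours in `X`. -/
structure IsBarrier (κ : Cardinal.{u}) (D : Digraph V) (X : Set V) : Prop where
  mk_outArcs_lt : #(D.outArcs X) < κ
  mk_out_lt : ∀ y, y ∉ X → #{z | z ∉ X ∧ D.Adj y z} < κ
  mk_in_lt : ∀ x, x ∈ X → #{z | z ∈ X ∧ D.Adj z x} < κ

/-- No cut with fewer than `κ` outgoing arcs separates `u` from `v`. -/
def Linked (κ : Cardinal.{u}) (D : Digraph V) (u v : V) : Prop :=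
  ∀ X, #(D.outArcs X) < κ → u ∈ X → v ∈ X

theorem mk_union_lt {α : Type u} {κ : Cardinal.{u}} (hκ : ℵ₀ ≤ κ) {s t : Set α} (hs : #s < κ)
    (ht : #t < κ) : #(s ∪ t : Set α) < κ :=
  (mk_union_le s t).trans_lt (add_lt_of_lt hκ hs ht)

theorem mk_singleton_lt {α : Type u} {κ : Cardinal.{u}} (hκ : ℵ₀ ≤ κ) (a : α) :
    #({a} : Set α) < κ := by
  rw [mk_singleton]
  exact one_lt_aleph0.trans_le hκ

theorem mk_left_lt {κ : Cardinal.{u}} {S : Set (V × V)} (hS : #S < κ) (y : V) :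
    #{z | (y, z) ∈ S} < κ :=
  (mk_preimage_of_injective (Prod.mk y) S fun _ _ h => (Prod.ext_iff.1 h).2).trans_lt hS

theorem mk_right_lt {κ : Cardinal.{u}} {S : Set (V × V)} (hS : #S < κ) (x : V) :
    #{z | (z, x) ∈ S} < κ :=
  (mk_preimage_of_injective (fun z => (z, x)) S fun _ _ h => (Prod.ext_iff.1 h).1).trans_lt hS

/-- The set reached from `u` without using `Z` has all its outgoing arcs in `Z`, so it is a small
cut and must contain `v`. -/
theorem Linked.reflTransGen {κ : Cardinal.{u}} {D : Digraph V} {u v : V} (h : Linked κ D u v)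
    {Z : Set (V × V)} (hZ : #Z < κ) :
    Relation.ReflTransGen (fun x y => D.Adj x y ∧ (x, y) ∉ Z) u v := by
  refine h {w | Relation.ReflTransGen (fun x y => D.Adj x y ∧ (x, y) ∉ Z) u w}
    ((mk_le_mk_of_subset ?_).trans_lt hZ) .refl
  rintro ⟨a, b⟩ ⟨ha, hb, hab⟩
  by_contra hnot
  exact hb (Relation.ReflTransGen.tail ha ⟨hab, hnot⟩)

/-- If many vertices `z` satisfy `y → z → x`, then `y` is linked to `x`. -/
theorem linked_of_many {κ : Cardinal.{u}} {D : Digraph V} {x y : V} {S : Set V} (hκ : ℵ₀ ≤ κ)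
    (hS : ¬ #S < κ) (h : ∀ z ∈ S, D.Adj y z ∧ D.Adj z x) : Linked κ D y x := by
  intro W hW hy
  by_contra hx
  -- Each `z` in `S` yields an arc leaving `W`, namely `(y, z)` or `(z, x)`.
  refine hS ((mk_le_mk_of_subset ?_).trans_lt
    (mk_union_lt hκ (mk_left_lt hW y) (mk_right_lt hW x)))
  intro z hz
  obtain ⟨h1, h2⟩ := h z hz
  by_cases hzW : z ∈ W
  · exact Or.inr ⟨hzW, hx, h2⟩
  · exact Or.inl ⟨hy, hzW, h1⟩

/-- After suitable reversals, every strong component with at least `κ` vertices has a barrier. -/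
theorem breakable_of_barrier {D : Digraph V} (hD : D.IsTournament) {κ : Cardinal.{u}}
    (hκ : ℵ₀ ≤ κ) (hV : #V ≤ κ)
    (hH : ∀ (W : Type u) (D' : Digraph W) (X : Set W), #W ≤ κ → D'.IsTournament →
      IsBarrier κ D' X → Breakable κ D') : Breakable κ D := by
  classical
  -- An arc is flipped if it opposes a one-way linkage, or if its ends are linked both ways and it
  -- descends in the well-order.
  let E : Set (V × V) := {p | D.Adj p.1 p.2 ∧ Linked κ D p.2 p.1 ∧
    (¬ Linked κ D p.1 p.2 ∨ WellOrderingRel p.2 p.1)}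
  have hEκ : #E ≤ κ := by
    refine (mk_set_le E).trans ?_
    rw [mk_prod]
    simp only [lift_id]
    exact mul_le_of_le hκ hV hV
  have hrev : Reversible D (symmHull E) Set.univ := by
    refine reversible_flip hD (fun a b h => h.1) (c := fun _ => κ) (fun _ => hκ)
      (fun _ => (mk_subtype_le _).trans hEκ) (fun _ => ?_)
      fun e Z hZ => e.2.2.1.reflTransGen hZ
    have : IsEmpty {e' : E // κ < κ} := ⟨fun e => lt_irrefl _ e.2⟩
    rw [mk_eq_zero]
    exact aleph0_pos.trans_le hκ
  refine Breakable.of_reversible hrev ?_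
  obtain ⟨D₁, hD₁⟩ : ∃ D₁, D₁ = D.flip (symmHull E) := ⟨_, rfl⟩
  rw [← hD₁]
  have hT : D₁.IsTournament := hD₁ ▸ hD.flip (isSymmSet_symmHull _)
  have hadj : ∀ a b, D₁.Adj a b → (D.Adj b a ∧ (b, a) ∈ E) ∨
      (D.Adj a b ∧ (a, b) ∉ E) := by
    intro a b h
    rw [hD₁] at h
    rcases h with ⟨h1 | h1, h2⟩ | ⟨h1, h2⟩
    · exact absurd h1.1 (hD.asymm h2)
    · exact Or.inl ⟨h2, h1⟩
    · exact Or.inr ⟨h2, fun h => h1 (Or.inl h)⟩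
  have F1 : ∀ a b, Linked κ D b a → ¬ Linked κ D a b → ¬ D₁.Adj a b := by
    intro a b h1 h2 h
    rcases hadj a b h with ⟨-, h⟩ | ⟨h3, h⟩
    · exact h2 h.2.1
    · exact h ⟨h3, h1, Or.inl h2⟩
  have F2 : ∀ a b, Linked κ D a b → Linked κ D b a → D₁.Adj a b → WellOrderingRel a b := by
    intro a b h1 h2 h
    rcases hadj a b h with ⟨-, -, -, h⟩ | ⟨h3, h4⟩
    · exact h.resolve_left fun h' => h' h2
    · rcases trichotomous_of WellOrderingRel a b with h5 | h5 | h5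
      · exact h5
      · exact absurd h5 (hT.ne h)
      · exact absurd ⟨h3, h2, Or.inr h5⟩ h4
  have F3 : ∀ a b, ¬ Linked κ D a b → D₁.Adj a b → D.Adj a b := by
    intro a b h1 h
    rcases hadj a b h with ⟨-, h⟩ | ⟨h3, -⟩
    · exact absurd h.2.1 h1
    · exact h3
  refine Breakable.of_comp fun a => ?_
  by_cases hK : #(D₁.comp a) < κ
  · exact breakable_of_comp_lt fun x => (mk_set_le _).trans_lt hK
  obtain ⟨a₀, b₀, ha₀, hb₀, X, hX, haX, hbX⟩ : ∃ a₀ b₀, a₀ ∈ D₁.comp a ∧ b₀ ∈ D₁.comp a ∧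
      ∃ X, #(D.outArcs X) < κ ∧ a₀ ∈ X ∧ b₀ ∉ X := by
    -- Otherwise all pairs in the component are linked both ways, so its arcs ascend in the
    -- well-order; having no directed cycle, it is a single vertex.
    by_contra! hno
    have hlink : ∀ b ∈ D₁.comp a, ∀ c ∈ D₁.comp a, Linked κ D b c := fun b hb c hc X hX hbX =>
      hno b c hb hc X hX hbX
    have hpath : ∀ b ∈ D₁.comp a, ∀ c ∈ D₁.comp a, b = c ∨ WellOrderingRel b c := by
      intro b hb c hc
      have hbc : D₁.Conn b c := hb.symm.trans hc
      have heq : D₁.comp a = D₁.comp b := hb.comp_eq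
      have := hbc.reach_within
      rw [← heq] at this
      clear hbc hc
      induction this with
      | refl => exact Or.inl rfl
      | tail _ h ih =>
        have h' := F2 _ _ (hlink _ h.1 _ h.2.1) (hlink _ h.2.1 _ h.1) h.2.2
        rcases ih with rfl | ih
        · exact Or.inr h'
        · exact Or.inr (trans_of WellOrderingRel ih h')
    refine hK ((mk_le_one_iff_set_subsingleton.2 ?_).trans_lt (one_lt_aleph0.trans_le hκ))
    intro b hb c hc
    rcases hpath b hb c hc with h | h
    · exact h
    · rcases hpath c hc b hb with h' | h'
      · exact h'.symm
      · exact absurd h' (asymm_of WellOrderingRel h)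
  -- The vertices of `A` can be added to `X`, and those of `B` kept outside or removed, while the
  -- cut stays small.
  let A : Set V := {v | #{z | z ∉ X ∧ D.Adj v z} < κ}
  let B : Set V := {v | #{z | z ∈ X ∧ D.Adj z v} < κ}
  have hXA : ∀ v ∈ X, v ∈ A := fun v hv =>
    (mk_le_mk_of_subset (t := {z | (v, z) ∈ D.outArcs X})
      fun z hz => ⟨hv, hz.1, hz.2⟩).trans_lt (mk_left_lt hX v)
  have hXB : ∀ v ∉ X, v ∈ B := fun v hv =>
    (mk_le_mk_of_subset (t := {z | (z, v) ∈ D.outArcs X})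
      fun z hz => ⟨hz.1, hv, hz.2⟩).trans_lt (mk_right_lt hX v)
  have hnl : ∀ x ∈ A, ∀ y ∈ B, x ≠ y → ¬ Linked κ D x y := by
    intro x hx y hy hxy h
    -- Moving `x` in and `y` out gives a small cut separating them.
    refine (h ((insert x X) \ {y}) ?_ ⟨Set.mem_insert _ _, hxy⟩).2 rfl
    have h1 : #(Prod.mk x '' {z | z ∉ X ∧ D.Adj x z}) < κ := mk_image_le.trans_lt hx
    have h2 : #((fun z => (z, y)) '' {z | z ∈ X ∧ D.Adj z y}) < κ := mk_image_le.trans_lt hy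
    refine (mk_le_mk_of_subset ?_).trans_lt (mk_union_lt hκ (mk_union_lt hκ hX
      (mk_singleton_lt hκ (x, y))) (mk_union_lt hκ h1 h2))
    rintro ⟨p, q⟩ ⟨hp, hq, hpq⟩
    have hq' : q = y ∨ q ∉ X := by
      by_contra! h3
      exact hq ⟨Or.inr h3.2, h3.1⟩
    rcases hp.1 with h3 | h3
    · rcases hq' with h4 | h4
      · exact Or.inl (Or.inr (Prod.ext h3 h4))
      · exact Or.inr (Or.inl ⟨q, ⟨h4, h3 ▸ hpq⟩, Prod.ext h3.symm rfl⟩)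
    · rcases hq' with h4 | h4
      · exact Or.inr (Or.inr ⟨p, ⟨h3, h4 ▸ hpq⟩, Prod.ext rfl h4.symm⟩)
      · exact Or.inl (Or.inl ⟨h3, h4, hpq⟩)
  have hl1 : ∀ x ∉ B, ∀ y ∈ B, Linked κ D y x := by
    intro x hx y hy
    refine linked_of_many (S := {z | z ∈ X ∧ D.Adj z x} \ ({z | z ∈ X ∧ D.Adj z y} ∪ {y})) hκ
      (fun h => hx ?_) fun z hz => ⟨?_, hz.1.2⟩
    · refine (mk_le_mk_of_subset ?_).trans_lt (mk_union_lt hκ h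
        (mk_union_lt hκ hy (mk_singleton_lt hκ y)))
      rw [Set.sdiff_union_self]
      exact Set.subset_union_left
    · exact hD.adj_of_not (fun h => hz.2 (Or.inr h)) fun h => hz.2 (Or.inl ⟨hz.1.1, h⟩)
  have hl2 : ∀ x ∈ A, ∀ y ∉ A, Linked κ D y x := by
    intro x hx y hy
    refine linked_of_many (S := {z | z ∉ X ∧ D.Adj y z} \ ({z | z ∉ X ∧ D.Adj x z} ∪ {x})) hκ
      (fun h => hy ?_) fun z hz => ⟨hz.1.2, ?_⟩
    · refine (mk_le_mk_of_subset ?_).trans_lt (mk_union_lt hκ h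
        (mk_union_lt hκ hx (mk_singleton_lt hκ x)))
      rw [Set.sdiff_union_self]
      exact Set.subset_union_left
    · exact hD.adj_of_not (fun h => hz.2 (Or.inr h.symm)) fun h => hz.2 (Or.inl ⟨hz.1.1, h⟩)
  have hAB : ∀ v, v ∈ A ∨ v ∈ B := fun v => (em (v ∈ X)).imp (hXA v) (hXB v)
  -- The linkages `hl1` and `hl2`, with no linkage back by `hnl`, force arcs of `D₁` never to ascend
  -- between the levels. A component is thus confined to one level; as it meets both `X` (inside
  -- `A`) and its complement (inside `B`), this is the middle one.
  let pos : V → ℕ := fun v => if v ∉ A then 2 else if v ∉ B then 0 else 1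
  have hpos : ∀ x y, D₁.Adj x y → pos y ≤ pos x := by
    intro x y h
    have hne := hT.ne h
    have G1 : x ∉ B → y ∈ B → False := fun hx hy =>
      F1 x y (hl1 x hx y hy) (hnl x ((hAB x).resolve_right hx) y hy hne) h
    have G2 : x ∈ A → y ∉ A → False := fun hx hy =>
      F1 x y (hl2 x hx y hy) (hnl x hx y ((hAB y).resolve_left hy) hne) h
    have := hAB x
    have := hAB y
    by_cases h1 : x ∈ A <;> by_cases h2 : x ∈ B <;> by_cases h3 : y ∈ A <;>
      by_cases h4 : y ∈ B <;> simp [pos, h1, h2, h3, h4] <;> tauto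
  have hreach : ∀ x y, D₁.Reach x y → pos y ≤ pos x := by
    intro x y h
    induction h with
    | refl => exact le_rfl
    | tail _ h ih => exact (hpos _ _ h).trans ih
  have hconn : ∀ x y, D₁.Conn x y → pos x = pos y := fun x y h =>
    le_antisymm (hreach _ _ h.2) (hreach _ _ h.1)
  have hpos1 : pos a₀ = 1 := by
    have h1 := hconn _ _ (ha₀.symm.trans hb₀)
    have h2 := hXA _ haX
    have h3 := hXB _ hbX
    simp only [pos, h2, h3, not_true, if_false] at h1 ⊢
    by_cases h4 : a₀ ∈ B <;> by_cases h5 : b₀ ∈ A <;> simp [h4, h5] at h1 ⊢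
  have hKAB : ∀ v ∈ D₁.comp a, v ∈ A ∧ v ∈ B := by
    intro v hv
    have h1 := hconn _ _ (ha₀.symm.trans hv)
    rw [hpos1] at h1
    by_cases h4 : v ∈ A <;> by_cases h5 : v ∈ B <;> simp [pos, h4, h5] at h1 ⊢
  -- Distinct vertices of the middle level are not linked, so no arc between them was flipped and
  -- the degree bounds for `D` carry over.
  have hDD : ∀ x y : D₁.comp a, D₁.Adj x y → D.Adj x y := fun x y h =>
    F3 _ _ (hnl _ (hKAB x x.2).1 _ (hKAB y y.2).2 (hT.ne h)) h
  refine hH _ _ {x | x.1 ∈ X} ((mk_set_le _).trans hV) (hT.induced _)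
    ⟨?_, fun y hy => ?_, fun x hx => ?_⟩
  · refine (mk_le_of_injective (f := fun p => (⟨(p.1.1.1, p.1.2.1), p.2.1, p.2.2.1,
      hDD _ _ p.2.2.2⟩ : D.outArcs X)) fun p q h => ?_).trans_lt hX
    have h' := congrArg Subtype.val h
    simp only [Prod.mk.injEq] at h'
    exact Subtype.ext (Prod.ext (Subtype.ext h'.1) (Subtype.ext h'.2))
  · refine (mk_le_of_injective (f := fun z => (⟨z.1.1, z.2.1, hDD _ _ z.2.2⟩ :
      {z | z ∉ X ∧ D.Adj y z})) fun p q h => ?_).trans_lt (hKAB y y.2).1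
    exact Subtype.ext (Subtype.ext (Subtype.mk.inj h))
  · refine (mk_le_of_injective (f := fun z => (⟨z.1.1, z.2.1, hDD _ _ z.2.2⟩ :
      {z | z ∈ X ∧ D.Adj z x})) fun p q h => ?_).trans_lt (hKAB x x.2).2
    exact Subtype.ext (Subtype.ext (Subtype.mk.inj h))

/-! ### Rays and tournaments with finite out-degrees -/

/-- König's lemma: an infinite set of reachable vertices yields a ray. -/
theorem exists_ray {R : V → V → Prop} (hfin : ∀ v, {z | R v z}.Finite) {u : V}
    (hinf : {z | Relation.ReflTransGen R u z}.Infinite) :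
    ∃ r : ℕ → V, r 0 = u ∧ Function.Injective r ∧ ∀ n, R (r n) (r (n + 1)) := by
  -- A state records the current vertex and the vertices already used; `Q` is what can still be
  -- reached while avoiding the latter. If it is infinite, it stays so for one of the finitely many
  -- successors.
  let Q : V × Set V → Set V := fun p =>
    {z | Relation.ReflTransGen (fun x y => R x y ∧ y ∉ p.2) p.1 z}
  have step : ∀ p : {p : V × Set V // (Q p).Infinite}, ∃ q : {p : V × Set V // (Q p).Infinite},
      R p.1.1 q.1.1 ∧ q.1.1 ∉ q.1.2 ∧ q.1.2 = insert p.1.1 p.1.2 := by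
    rintro ⟨⟨v, W⟩, hp⟩
    by_contra! hno
    refine hp (((Set.finite_singleton v).union
      ((hfin v).biUnion (t := fun s => {z | s ∉ insert v W ∧ z ∈ Q (s, insert v W)})
        fun s hs => ?_)).subset ?_)
    · by_contra hinf
      obtain ⟨z, hz⟩ := Set.Infinite.nonempty hinf
      exact hno ⟨(s, insert v W), Set.Infinite.mono (fun _ h => h.2) hinf⟩ hs hz.1 rfl
    · intro z hz
      change Relation.ReflTransGen (fun x y => R x y ∧ y ∉ W) v z at hz
      induction hz with
      | refl => exact Or.inl rfl
      | @tail b c _ hbc ih =>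
        by_cases hcv : c = v
        · exact Or.inl hcv
        · have hc : c ∉ insert v W := by
            rintro (h | h)
            · exact hcv h
            · exact hbc.2 h
          refine Or.inr (Set.mem_iUnion₂.2 ?_)
          rcases ih with h | h
          · have hb : b = v := h
            subst hb
            exact ⟨c, hbc.1, hc, .refl⟩
          · obtain ⟨s, hs, h⟩ := Set.mem_iUnion₂.1 h
            exact ⟨s, hs, h.1, Relation.ReflTransGen.tail h.2 ⟨hbc.1, hc⟩⟩
  choose f hf1 hf2 hf3 using step
  let p : ℕ → {p : V × Set V // (Q p).Infinite} := fun n =>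
    Nat.rec ⟨(u, ∅), by simpa [Q] using hinf⟩ (fun _ q => f q) n
  have hps : ∀ n, p (n + 1) = f (p n) := fun n => rfl
  have hmem : ∀ m n, m < n → (p m).1.1 ∈ (p n).1.2 := by
    intro m n hmn
    induction n with
    | zero => omega
    | succ n ih =>
      rw [hps, hf3]
      rcases (Nat.lt_succ_iff.1 hmn).eq_or_lt with rfl | h
      · exact Set.mem_insert _ _
      · exact Set.mem_insert_of_mem _ (ih h)
  have hne : ∀ m n, m < n → (p m).1.1 ≠ (p n).1.1 := by
    intro m n hmn heq
    obtain ⟨k, rfl⟩ := Nat.exists_eq_succ_of_ne_zero (Nat.ne_zero_of_lt hmn)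
    have h1 := hmem _ _ hmn
    rw [heq] at h1
    rw [Nat.succ_eq_add_one, hps] at h1
    exact hf2 _ h1
  refine ⟨fun n => (p n).1.1, rfl, fun m n h => ?_, fun n => ?_⟩
  · rcases lt_trichotomy m n with hlt | heq | hlt
    · exact absurd h (hne _ _ hlt)
    · exact heq
    · exact absurd h.symm (hne _ _ hlt)
  · change R (p n).1.1 (p (n + 1)).1.1
    rw [hps]
    exact hf1 _

theorem mem_symmHull_singleton {p : V × V} {a b : V} :
    p ∈ symmHull {(a, b)} ↔ p = (a, b) ∨ p = (b, a) := by
  obtain ⟨c, d⟩ := p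
  simp [symmHull, and_comm]

/-- A vertex meets at most two arcs of a ray, so reversing a ray keeps finite degrees finite. -/
theorem finite_ray_neighbours {r : ℕ → V} (hr : Function.Injective r) (v : V) :
    {z | (v, z) ∈ symmHull (⋃ n, {(r n, r (n + 1))})}.Finite := by
  by_cases h : ∃ m, r m = v
  · obtain ⟨m, rfl⟩ := h
    refine (Set.toFinite {r (m + 1), r (m - 1)}).subset ?_
    intro z hz
    change (r m, z) ∈ symmHull (⋃ n, {(r n, r (n + 1))}) at hz
    simp only [symmHull_iUnion, Set.mem_iUnion, mem_symmHull_singleton, Prod.mk.injEq,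
      hr.eq_iff] at hz
    obtain ⟨n, ⟨rfl, rfl⟩ | ⟨rfl, rfl⟩⟩ := hz
    · exact Or.inl rfl
    · exact Or.inr rfl
  · push Not at h
    have : {z | (v, z) ∈ symmHull (⋃ n, {(r n, r (n + 1))})} = ∅ := by
      ext z
      simp only [symmHull_iUnion, Set.mem_ofPred_eq, Set.mem_iUnion, mem_symmHull_singleton,
        Prod.mk.injEq, Set.mem_empty_iff_false, iff_false, not_exists]
      rintro n (⟨h', -⟩ | ⟨h', -⟩)
      · exact h _ h'.symm
      · exact h _ h'.symm
    rw [this]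
    exact Set.finite_empty

theorem finite_out_flip {D : Digraph V} {N : Set (V × V)} {v : V} (h : {z | D.Adj v z}.Finite)
    (hN : {z | (v, z) ∈ N}.Finite) : {z | (D.flip N).Adj v z}.Finite := by
  refine (h.union hN).subset ?_
  rintro z (⟨h, -⟩ | ⟨-, h⟩)
  · exact Or.inr h
  · exact Or.inl h

/-- A ray all of whose later vertices send arcs to its initial vertex can be reversed. -/
theorem reversible_ray {D : Digraph V} (hD : D.IsTournament) {r : ℕ → V}
    (hr : Function.Injective r) (hadj : ∀ n, D.Adj (r n) (r (n + 1)))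
    (hback : ∀ n, D.Adj (r (n + 2)) (r 0)) :
    Reversible D (symmHull (⋃ n, {(r n, r (n + 1))})) (Set.range r ×ˢ Set.range r) := by
  have hA : ∀ n p, p ∈ symmHull ((({(r (n + 1), r 0)} : Finset (V × V))) : Set (V × V)) ↔
      p = (r (n + 1), r 0) ∨ p = (r 0, r (n + 1)) := fun n p => by
    rw [Finset.coe_singleton, mem_symmHull_singleton]
  have hB : ∀ n p, p ∈ symmHull ((({(r (n + 1), r (n + 2))} : Finset (V × V))) : Set (V × V)) ↔
      p = (r (n + 1), r (n + 2)) ∨ p = (r (n + 2), r (n + 1)) := fun n p => by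
    rw [Finset.coe_singleton, mem_symmHull_singleton]
  -- The blocks are the triangles on `r 0`, `r (n + 1)`, `r (n + 2)`; consecutive triangles share a
  -- chord at `r 0`, which is reversed twice.
  have h := reversible_push hD (A := fun n => {(r (n + 1), r 0)})
    (B := fun n => {(r (n + 1), r (n + 2))}) ?_ ?_ ?_ ?_ ?_ ?_ ?_
  · have e : symmHull (((({(r (0 + 1), r 0)} : Finset (V × V))) : Set (V × V)) ∪
        ⋃ n, ((({(r (n + 1), r (n + 2))} : Finset (V × V))) : Set (V × V))) =
        symmHull (⋃ n, {(r n, r (n + 1))}) := by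
      ext p
      simp only [symmHull_union, symmHull_iUnion, Set.mem_union, Set.mem_iUnion, hA, hB,
        mem_symmHull_singleton]
      constructor
      · rintro ((h | h) | ⟨n, h⟩)
        · exact ⟨0, Or.inr h⟩
        · exact ⟨0, Or.inl h⟩
        · exact ⟨n + 1, h⟩
      · rintro ⟨_ | n, h⟩
        · exact Or.inl h.symm
        · exact Or.inr ⟨n, h⟩
    rw [e] at h
    refine h.mono ?_
    intro p hp
    simp only [symmHull_union, symmHull_iUnion, Set.mem_union, Set.mem_iUnion, hA, hB] at hp
    rcases hp with ⟨n, rfl | rfl⟩ | ⟨n, rfl | rfl⟩ <;> exact ⟨⟨_, rfl⟩, ⟨_, rfl⟩⟩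
  · intro a b h
    obtain ⟨rfl, rfl⟩ : a = r 1 ∧ b = r 0 := by simpa using h
    exact hadj 0
  · intro n a b h
    obtain ⟨rfl, rfl⟩ : a = r (n + 2) ∧ b = r 0 := by simpa using h
    exact hback n
  · intro n a b h
    obtain ⟨rfl, rfl⟩ : a = r (n + 1) ∧ b = r (n + 2) := by simpa using h
    exact hadj (n + 1)
  · intro m n p hm hn
    rw [hA] at hm hn
    rcases hm with rfl | rfl <;> rcases hn with h | h <;>
      simp only [Prod.mk.injEq, hr.eq_iff] at h <;> omega
  · intro m n p hm hn
    rw [hB] at hm hn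
    rcases hm with rfl | rfl <;> rcases hn with h | h <;>
      simp only [Prod.mk.injEq, hr.eq_iff] at h <;> omega
  · intro m n p hm hn
    rw [hA] at hm
    rw [hB] at hn
    rcases hm with rfl | rfl <;> rcases hn with h | h <;>
      simp only [Prod.mk.injEq, hr.eq_iff] at h <;> omega
  · intro n
    simp only [divergence_singleton]
    abel

/-- If all out-degrees are finite, then the strong component of a given vertex can be made
finite. -/
theorem exists_finite_comp {D : Digraph V} (hD : D.IsTournament)
    (hfin : ∀ v, {z | D.Adj v z}.Finite) (a : V) :
    ∃ N T, Reversible D N T ∧ T ⊆ D.comp a ×ˢ D.comp a ∧ ((D.comp a).Finite → T = ∅) ∧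
      (∀ v, {z | (D.flip N).Adj v z}.Finite) ∧ ((D.flip N).comp a).Finite := by
  induction hd : {z | D.Adj a z}.ncard using Nat.strong_induction_on generalizing D with
  | _ d ih =>
    subst hd
    by_cases hc : (D.comp a).Finite
    · exact ⟨∅, ∅, reversible_empty _ _, Set.empty_subset _, fun _ => rfl, by simpa, by simpa⟩
    obtain ⟨r, hr0, hr, hradj⟩ := exists_ray
      (R := fun x y => x ∈ D.comp a ∧ y ∈ D.comp a ∧ D.Adj x y) (u := a)
      (fun v => (hfin v).subset fun z hz => hz.2.2)
      (Set.Infinite.mono (fun z hz => Conn.reach_within hz) hc)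
    have hI : {n | D.Adj a (r n)}.Finite := (hfin a).preimage hr.injOn
    have hI1 : 1 ∈ {n | D.Adj a (r n)} := by
      have := (hradj 0).2.2
      rwa [hr0] at this
    -- Jumping from `a` to its last out-neighbour on the ray gives a ray `q` whose later vertices
    -- all send arcs to `a`. Reversing `q` costs `a` the out-neighbour `q 1` and gains none, so the
    -- out-degree drops.
    obtain ⟨m, hm, hmax⟩ := hI.exists_maximal ⟨1, hI1⟩
    have hm1 : 1 ≤ m := (le_total 1 m).elim id fun h => hmax hI1 h
    have hlast : ∀ n, m < n → ¬ D.Adj a (r n) := fun n hn h =>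
      absurd (hmax h hn.le) (not_le.2 hn)
    let q : ℕ → V := fun n => if n = 0 then a else r (m + n - 1)
    have hq : Function.Injective q := by
      intro i j hij
      by_cases hi : i = 0 <;> by_cases hj : j = 0 <;>
        simp only [q, hi, hj, if_true, if_false, ← hr0, hr.eq_iff] at hij ⊢ <;> omega
    have hqs : ∀ n, q (n + 1) = r (m + n) := fun n => by
      simp only [q, Nat.add_eq_zero_iff, one_ne_zero, and_false, if_false]
      congr 1
    have hqadj : ∀ n, D.Adj (q n) (q (n + 1)) := by
      intro n
      rcases n with _ | n
      · rw [hqs]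
        exact hm
      · rw [hqs, hqs]
        exact (hradj _).2.2
    have hback : ∀ n, D.Adj (q (n + 2)) (q 0) := by
      intro n
      have hne : q 0 ≠ q (n + 2) := fun h => by
        have := hq h
        omega
      refine hD.adj_of_not hne ?_
      rw [hqs]
      exact hlast _ (by omega)
    have hqcomp : ∀ n, q n ∈ D.comp a := by
      intro n
      rcases n with _ | n
      · exact Conn.refl D a
      · rw [hqs]
        exact (hradj _).1
    have hrev := reversible_ray hD hq hqadj hback
    set N := symmHull (⋃ n, {(q n, q (n + 1))}) with hN
    have hTc : Set.range q ×ˢ Set.range q ⊆ D.comp a ×ˢ D.comp a :=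
      Set.prod_mono (Set.range_subset_iff.2 hqcomp) (Set.range_subset_iff.2 hqcomp)
    have hfin' : ∀ v, {z | (D.flip N).Adj v z}.Finite := fun v =>
      finite_out_flip (hfin v) (finite_ray_neighbours hq v)
    have hlt : {z | (D.flip N).Adj a z}.ncard < {z | D.Adj a z}.ncard := by
      have hmemN : ∀ z, (a, z) ∈ N → z = q 1 := by
        intro z hz
        have ha : a = q 0 := rfl
        rw [hN, ha] at hz
        simp only [symmHull_iUnion, Set.mem_iUnion, mem_symmHull_singleton, Prod.mk.injEq,
          hq.eq_iff] at hz
        obtain ⟨n, ⟨rfl, h⟩ | ⟨h, -⟩⟩ := hz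
        · exact h
        · omega
      have h1N : (a, q 1) ∈ N := Or.inl (Set.mem_iUnion.2 ⟨0, rfl⟩)
      have h1 : D.Adj a (q 1) := hqadj 0
      have h1' : ¬ (D.flip N).Adj a (q 1) := by
        rw [flip_adj_of_mem h1N]
        exact hD.asymm h1
      refine Set.ncard_lt_ncard ⟨fun z hz => ?_, fun h => h1' (h h1)⟩ (hfin a)
      rcases hz with ⟨h, h'⟩ | ⟨-, h⟩
      · rw [hmemN z h] at h'
        exact absurd h' (hD.asymm h1)
      · exact h
    have hreach : ∀ x y, (x, y) ∈ N → D.Reach x y := fun x y h => by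
      have := hTc (hrev.subset h)
      exact (this.1.symm.trans this.2).1
    obtain ⟨M, T, h1, h2, -, h4, h5⟩ := ih _ hlt (hD.flip (isSymmSet_symmHull _)) hfin' rfl
    have hsub : (D.flip N).comp a ⊆ D.comp a := fun z hz => conn_flip hreach hz
    refine ⟨symmDiff N M, _, hrev.trans h1, Set.union_subset hTc
      (h2.trans (Set.prod_mono hsub hsub)), fun h => absurd h hc, ?_, ?_⟩
    · rwa [← flip_flip (isSymmSet_symmHull _)]
    · rwa [← flip_flip (isSymmSet_symmHull _)]

/-- A countable tournament with finite out-degrees can be broken into finite components. -/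
theorem breakable_of_finite_out [Countable V] {D : Digraph V} (hD : D.IsTournament)
    (hfin : ∀ v, {z | D.Adj v z}.Finite) : Breakable ℵ₀ D := by
  rcases isEmpty_or_nonempty V with hV | hV
  · exact breakable_of_comp_lt fun a => isEmptyElim a
  obtain ⟨e, he⟩ := exists_surjective_nat V
  have step : ∀ (G : {G : Digraph V // G.IsTournament ∧ ∀ v, {z | G.Adj v z}.Finite}) (a : V),
      ∃ N T, Reversible G.1 N T ∧ T ⊆ G.1.comp a ×ˢ G.1.comp a ∧
        ((G.1.comp a).Finite → T = ∅) ∧ (∀ v, {z | (G.1.flip N).Adj v z}.Finite) ∧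
        ((G.1.flip N).comp a).Finite := fun G a => exists_finite_comp G.2.1 G.2.2 a
  choose N T h1 h2 h3 h4 h5 using step
  let G : ℕ → {G : Digraph V // G.IsTournament ∧ ∀ v, {z | G.Adj v z}.Finite} := fun n =>
    Nat.rec ⟨D, hD, hfin⟩ (fun n G => ⟨G.1.flip (N G (e n)),
      G.2.1.flip (h1 G (e n)).isSymmSet, h4 G (e n)⟩) n
  have hGs : ∀ n, (G (n + 1)).1 = (G n).1.flip (N (G n) (e n)) := fun n => rfl
  have hconn1 : ∀ n x y, (G (n + 1)).1.Conn x y → (G n).1.Conn x y := by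
    intro n x y h
    refine conn_flip (fun a b hab => ?_) h
    have := h2 _ _ ((h1 (G n) (e n)).subset hab)
    exact (this.1.symm.trans this.2).1
  have hconn : ∀ m n, m ≤ n → ∀ x y, (G n).1.Conn x y → (G m).1.Conn x y := by
    intro m n hmn
    induction n, hmn using Nat.le_induction with
    | base => exact fun x y h => h
    | succ n _ ih => exact fun x y h => ih x y (hconn1 n x y h)
  have hfinc : ∀ n, ((G (n + 1)).1.comp (e n)).Finite := fun n => h5 (G n) (e n)
  -- After stage `i` the component of `e i` is finite and is only refined later, whereas a stage
  -- with nonempty `T` works inside an infinite component. So later stages never touch `e i`, which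
  -- gives local finiteness.
  have hTi : ∀ i n p, p.1 = e i → p ∈ T (G n) (e n) → n ≤ i := by
    intro i n p hp hpT
    by_contra! hin
    have hinf : ¬ ((G n).1.comp (e n)).Finite := fun h => by
      rw [h3 _ _ h] at hpT
      exact hpT
    have hx := (h2 _ _ hpT).1
    rw [hp] at hx
    rw [Conn.comp_eq hx] at hinf
    exact hinf ((hfinc i).subset fun z hz => hconn (i + 1) n hin _ _ hz)
  have hTfin : ∀ p, {n | p ∈ T (G n) (e n)}.Finite := by
    intro p
    obtain ⟨i, hi⟩ := he p.1
    exact (Set.finite_Iic i).subset fun n hn => hTi i n p hi.symm hn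
  obtain ⟨hrev, hstate⟩ := Reversible.concat_nat (D := fun n => (G n).1)
    (N := fun n => N (G n) (e n)) (T := fun n => T (G n) (e n)) (fun n => h1 _ _) hGs hTfin
  refine ⟨_, hrev.mono (Set.subset_univ _), fun a => ?_⟩
  obtain ⟨i, rfl⟩ := he a
  set D' := (G 0).1.flip (oddSet (fun n => N (G n) (e n)) Set.univ) with hD'
  have hadj : ∀ a b, D'.Adj a b → ∃ m, ∀ n, m ≤ n → (G n).1.Adj a b := by
    intro a b hab
    obtain ⟨i, hi⟩ := he a
    refine ⟨i + 1, fun n hn => ?_⟩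
    have hn' : (a, b) ∈ oddSet (fun n => N (G n) (e n)) (Set.Iio n) ↔
        (a, b) ∈ oddSet (fun n => N (G n) (e n)) Set.univ := by
      have : {j | j ∈ Set.Iio n ∧ (a, b) ∈ N (G j) (e j)} =
          {j | j ∈ Set.univ ∧ (a, b) ∈ N (G j) (e j)} := by
        ext j
        refine ⟨fun h => ⟨trivial, h.2⟩, fun h => ⟨?_, h.2⟩⟩
        have := hTi i j _ hi.symm ((h1 _ _).subset h.2)
        exact Set.mem_Iio.2 (by omega)
      simp only [oddSet, Set.mem_ofPred_eq] at this ⊢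
      rw [this]
    rw [hstate n]
    rw [hD'] at hab
    simpa only [flip, hn'] using hab
  -- A path of the limit is finite, hence present at all late stages; components of the limit thus
  -- refine those of every stage.
  have hreach : ∀ a b, D'.Reach a b → ∃ m, ∀ n, m ≤ n → (G n).1.Reach a b := by
    intro a b hab
    induction hab with
    | refl => exact ⟨0, fun n _ => .refl⟩
    | tail _ h ih =>
      obtain ⟨m, hm⟩ := ih
      obtain ⟨k, hk⟩ := hadj _ _ h
      exact ⟨max m k, fun n hn => (hm n (le_of_max_le_left hn)).tail
        (hk n (le_of_max_le_right hn))⟩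
  refine lt_aleph0_iff_set_finite.2 ((hfinc i).subset fun b hb => ?_)
  obtain ⟨m, hm⟩ := hreach _ _ hb.1
  obtain ⟨k, hk⟩ := hreach _ _ hb.2
  refine hconn (i + 1) (max (max m k) (i + 1)) (le_max_right _ _) _ _ ⟨hm _ ?_, hk _ ?_⟩
  · exact (le_max_left _ _).trans (le_max_left _ _)
  · exact (le_max_right _ _).trans (le_max_left _ _)

/-- No component crosses `X`. A component outside `X` has finite out-degrees, and one inside has
finite in-degrees and is handled in the opposite digraph. -/
theorem breakable_of_barrier_of_no_outArcs [Countable V] {D : Digraph V} (hD : D.IsTournament)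
    {X : Set V} (h : IsBarrier ℵ₀ D X) (h0 : D.outArcs X = ∅) : Breakable ℵ₀ D := by
  have hstep : ∀ a b, D.Reach a b → a ∈ X → b ∈ X := by
    intro a b hab ha
    induction hab with
    | refl => exact ha
    | tail _ hbc ih =>
      by_contra hc
      exact Set.eq_empty_iff_forall_notMem.1 h0 (_, _) ⟨ih, hc, hbc⟩
  refine Breakable.of_comp fun a => ?_
  by_cases ha : a ∈ X
  · have hK : ∀ b ∈ D.comp a, b ∈ X := fun b hb => hstep _ _ hb.1 ha
    refine Breakable.op (D := (D.induced (D.comp a)).op) ?_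
    refine breakable_of_finite_out (hD.induced _).op fun v => ?_
    refine ((lt_aleph0_iff_set_finite.1 (h.mk_in_lt v (hK v v.2))).preimage
      (f := Subtype.val) Subtype.val_injective.injOn).subset fun z hz => ⟨hK z z.2, hz⟩
  · have hK : ∀ b ∈ D.comp a, b ∉ X := fun b hb hbX => ha (hstep _ _ hb.2 hbX)
    refine breakable_of_finite_out (hD.induced _) fun v => ?_
    refine ((lt_aleph0_iff_set_finite.1 (h.mk_out_lt v (hK v v.2))).preimage
      (f := Subtype.val) Subtype.val_injective.injOn).subset fun z hz => ⟨hK z z.2, hz⟩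

/-! ### Breaking countable barriers -/

/-- Two rays, one running away from the head of an arc and one running towards its tail, can be
reversed together with that arc if their later vertices are joined suitably. -/
theorem reversible_double_ray {D : Digraph V} (hD : D.IsTournament) {x y : ℕ → V}
    (hx : Function.Injective x) (hy : Function.Injective y) (hxy : ∀ m n, x m ≠ y n)
    (hxadj : ∀ n, D.Adj (x (n + 1)) (x n)) (hyadj : ∀ n, D.Adj (y n) (y (n + 1)))
    (h0 : D.Adj (x 0) (y 0)) (hback : ∀ n, D.Adj (y (n + 1)) (x (n + 1))) :
    Reversible D (symmHull {(x 0, y 0)} ∪ (symmHull (⋃ n, {(y n, y (n + 1))}) ∪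
      symmHull (⋃ n, {(x n, x (n + 1))}))) Set.univ := by
  classical
  have hyx : ∀ m n, y m ≠ x n := fun m n h => hxy _ _ h.symm
  have hA : ∀ n p, p ∈ symmHull ((({(y n, x n)} : Finset (V × V))) : Set (V × V)) ↔
      p = (y n, x n) ∨ p = (x n, y n) := fun n p => by
    rw [Finset.coe_singleton, mem_symmHull_singleton]
  have hB : ∀ n p, p ∈ symmHull ((({(y n, y (n + 1)), (x (n + 1), x n)} : Finset (V × V))) :
      Set (V × V)) ↔ (p = (y n, y (n + 1)) ∨ p = (y (n + 1), y n)) ∨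
        (p = (x (n + 1), x n) ∨ p = (x n, x (n + 1))) := fun n p => by
    rw [Finset.coe_insert, Finset.coe_singleton, Set.insert_eq, symmHull_union, Set.mem_union,
      mem_symmHull_singleton, mem_symmHull_singleton]
  -- The blocks are the 4-cycles through `y n`, `y (n + 1)`, `x (n + 1)`, `x n`; consecutive ones
  -- share a rung.
  have h := reversible_push hD (A := fun n => {(y n, x n)})
    (B := fun n => {(y n, y (n + 1)), (x (n + 1), x n)}) ?_ ?_ ?_ ?_ ?_ ?_ ?_
  · have e : symmHull ((((({(y 0, x 0)} : Finset (V × V))) : Set (V × V)) ∪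
        ⋃ n, ((({(y n, y (n + 1)), (x (n + 1), x n)} : Finset (V × V))) : Set (V × V)))) =
        symmHull {(x 0, y 0)} ∪ (symmHull (⋃ n, {(y n, y (n + 1))}) ∪
          symmHull (⋃ n, {(x n, x (n + 1))})) := by
      ext p
      simp only [symmHull_union, symmHull_iUnion, Set.mem_union, Set.mem_iUnion, hA, hB,
        mem_symmHull_singleton, exists_or]
      rw [or_comm (a := p = (y 0, x 0))]
      simp only [or_comm, or_left_comm]
    rw [e] at h
    exact h.mono (Set.subset_univ _)
  · intro a b h
    obtain ⟨rfl, rfl⟩ : a = y 0 ∧ b = x 0 := by simpa using h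
    exact h0
  · intro n a b h
    obtain ⟨rfl, rfl⟩ : a = y (n + 1) ∧ b = x (n + 1) := by simpa using h
    exact hback n
  · intro n a b h
    have h' : (a = y n ∧ b = y (n + 1)) ∨ (a = x (n + 1) ∧ b = x n) := by simpa using h
    rcases h' with ⟨rfl, rfl⟩ | ⟨rfl, rfl⟩
    · exact hyadj n
    · exact hxadj n
  · intro m n p hm hn
    rw [hA] at hm hn
    rcases hm with rfl | rfl <;> rcases hn with h | h <;>
      simp only [Prod.mk.injEq, hx.eq_iff, hxy, hyx, and_false] at h <;> omega
  · intro m n p hm hn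
    rw [hB] at hm hn
    rcases hm with (rfl | rfl) | (rfl | rfl) <;> rcases hn with (h | h) | (h | h) <;>
      simp only [Prod.mk.injEq, hx.eq_iff, hy.eq_iff, hxy, hyx, and_false] at h <;>
      omega
  · intro m n p hm hn
    rw [hA] at hm
    rw [hB] at hn
    rcases hm with rfl | rfl <;> rcases hn with (h | h) | (h | h) <;>
      simp only [Prod.mk.injEq, hxy, hyx, false_and, and_false] at h
  · intro n
    have hne : (y n, y (n + 1)) ≠ (x (n + 1), x n) := fun h => hyx _ _ (Prod.ext_iff.1 h).1
    rw [divergence, Finset.sum_pair hne]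
    simp only [divergence_singleton]
    abel

/-- Induction on the number of cut arcs. Given a cut arc `xy`, if `y` reaches only finitely many
vertices outside `X`, these are moved into `X`; if only finitely many vertices reach `x` inside `X`,
they are moved out. Either change loses `xy` and creates no cut arc. Otherwise there are rays on
both sides, and reversing a double ray removes a cut arc. -/
theorem breakable_of_barrier_countable [Countable V] {D : Digraph V} (hD : D.IsTournament)
    {X : Set V} (h : IsBarrier ℵ₀ D X) : Breakable ℵ₀ D := by
  induction hd : (D.outArcs X).ncard using Nat.strong_induction_on generalizing D X with
  | _ d ih =>
    subst hd
    have hfin : (D.outArcs X).Finite := lt_aleph0_iff_set_finite.1 h.mk_outArcs_lt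
    have hout : ∀ y, y ∉ X → {z | z ∉ X ∧ D.Adj y z}.Finite := fun y hy =>
      lt_aleph0_iff_set_finite.1 (h.mk_out_lt y hy)
    have hin : ∀ x, x ∈ X → {z | z ∈ X ∧ D.Adj z x}.Finite := fun x hx =>
      lt_aleph0_iff_set_finite.1 (h.mk_in_lt x hx)
    have hleft : ∀ x, {z | (x, z) ∈ D.outArcs X}.Finite := fun x =>
      lt_aleph0_iff_set_finite.1 (mk_left_lt h.mk_outArcs_lt x)
    have hright : ∀ y, {z | (z, y) ∈ D.outArcs X}.Finite := fun y =>
      lt_aleph0_iff_set_finite.1 (mk_right_lt h.mk_outArcs_lt y)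
    rcases (D.outArcs X).eq_empty_or_nonempty with h0 | ⟨⟨x, y⟩, hxX, hyX, hxy⟩
    · exact breakable_of_barrier_of_no_outArcs hD h h0
    have hxyX : (x, y) ∈ D.outArcs X := ⟨hxX, hyX, hxy⟩
    let R₁ : V → V → Prop := fun p q => (p ∉ X ∧ q ∉ X) ∧ D.Adj p q
    let R₂ : V → V → Prop := fun p q => (p ∈ X ∧ q ∈ X) ∧ D.Adj q p
    by_cases hy : {z | Relation.ReflTransGen R₁ y z}.Finite
    · set Y := {z | Relation.ReflTransGen R₁ y z} with hY
      have hsub : D.outArcs (X ∪ Y) ⊂ D.outArcs X := by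
        refine ⟨?_, fun h' => (h' hxyX).2.1 (Or.inr .refl)⟩
        rintro ⟨p, q⟩ ⟨hp, hq, hpq⟩
        have hqX : q ∉ X := fun h' => hq (Or.inl h')
        refine ⟨?_, hqX, hpq⟩
        by_contra hpX
        have hpY := hp.resolve_left hpX
        exact hq (Or.inr (Relation.ReflTransGen.tail hpY ⟨⟨hpX, hqX⟩, hpq⟩))
      refine ih _ (Set.ncard_lt_ncard hsub hfin) hD (X := X ∪ Y)
        ⟨?_, fun v hv => ?_, fun v hv => ?_⟩ rfl
      · exact lt_aleph0_iff_set_finite.2 (hfin.subset hsub.1)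
      · refine lt_aleph0_iff_set_finite.2 ((hout v fun h' => hv (Or.inl h')).subset ?_)
        exact fun z hz => ⟨fun h' => hz.1 (Or.inl h'), hz.2⟩
      · refine lt_aleph0_iff_set_finite.2 ?_
        by_cases hvX : v ∈ X
        · exact ((hin v hvX).union hy).subset fun z hz => hz.1.imp (fun h' => ⟨h', hz.2⟩) id
        · exact ((hright v).union hy).subset fun z hz =>
            hz.1.imp (fun h' => ⟨h', hvX, hz.2⟩) id
    by_cases hx : {z | Relation.ReflTransGen R₂ x z}.Finite
    · set Y := {z | Relation.ReflTransGen R₂ x z} with hY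
      have hYX : ∀ z ∈ Y, z ∈ X := by
        intro z hz
        change Relation.ReflTransGen R₂ x z at hz
        induction hz with
        | refl => exact hxX
        | tail _ h' _ => exact h'.1.2
      have hsub : D.outArcs (X \ Y) ⊂ D.outArcs X := by
        refine ⟨?_, fun h' => (h' hxyX).1.2 .refl⟩
        rintro ⟨p, q⟩ ⟨hp, hq, hpq⟩
        refine ⟨hp.1, fun hqX => ?_, hpq⟩
        have hqY : q ∈ Y := by
          by_contra h'
          exact hq ⟨hqX, h'⟩
        exact hp.2 (Relation.ReflTransGen.tail hqY ⟨⟨hqX, hp.1⟩, hpq⟩)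
      refine ih _ (Set.ncard_lt_ncard hsub hfin) hD (X := X \ Y)
        ⟨?_, fun v hv => ?_, fun v hv => ?_⟩ rfl
      · exact lt_aleph0_iff_set_finite.2 (hfin.subset hsub.1)
      · refine lt_aleph0_iff_set_finite.2 ?_
        have hz' : ∀ z, z ∉ X \ Y → z ∉ X ∨ z ∈ Y := fun z hz => by
          by_contra! h'
          exact hz h'
        by_cases hvX : v ∈ X
        · exact ((hleft v).union hx).subset fun z hz =>
            (hz' z hz.1).imp (fun h' => ⟨hvX, h', hz.2⟩) id
        · exact ((hout v hvX).union hx).subset fun z hz =>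
            (hz' z hz.1).imp (fun h' => ⟨h', hz.2⟩) id
      · exact lt_aleph0_iff_set_finite.2 ((hin v hv.1).subset fun z hz => ⟨hz.1.1, hz.2⟩)
    obtain ⟨ry, hry0, hry, hryadj⟩ := exists_ray (R := R₁) (u := y) (fun v => by
      by_cases hv : v ∈ X
      · exact Set.finite_empty.subset fun z hz => hz.1.1 hv
      · exact (hout v hv).subset fun z hz => ⟨hz.1.2, hz.2⟩) hy
    obtain ⟨rx, hrx0, hrx, hrxadj⟩ := exists_ray (R := R₂) (u := x) (fun v => by
      by_cases hv : v ∈ X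
      · exact (hin v hv).subset fun z hz => ⟨hz.1.2, hz.2⟩
      · exact Set.finite_empty.subset fun z hz => hv hz.1.1) hx
    have hI : {n | (rx n, ry n) ∈ D.outArcs X}.Finite :=
      hfin.preimage fun a _ b _ hab => hrx (Prod.ext_iff.1 hab).1
    -- Start at the last rung that leaves `X`: all later rungs run back towards `X`, as the double
    -- ray requires. Apart from this rung only arcs within the two sides are flipped, so the cut
    -- loses exactly one arc.
    obtain ⟨m, hm, hmax⟩ := hI.exists_maximal ⟨0, by
      change (rx 0, ry 0) ∈ D.outArcs X
      rwa [hrx0, hry0]⟩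
    have hne : ∀ i j, rx i ≠ ry j := fun i j hij => (hryadj j).1.1 (hij ▸ (hrxadj i).1.1)
    have hrev := reversible_double_ray hD (x := fun n => rx (m + n)) (y := fun n => ry (m + n))
      (fun i j hij => Nat.add_left_cancel (hrx hij)) (fun i j hij => Nat.add_left_cancel (hry hij))
      (fun i j => hne _ _) (fun n => (hrxadj (m + n)).2) (fun n => (hryadj (m + n)).2) hm.2.2
      (fun n => by
        refine hD.adj_of_not (hne _ _) fun hadj => ?_
        have := hmax (y := m + (n + 1)) ⟨(hrxadj _).1.1, (hryadj _).1.1, hadj⟩ (by omega)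
        omega)
    refine Breakable.of_reversible hrev ?_
    have hxm : rx m ∈ X := (hrxadj m).1.1
    have hym : ry m ∉ X := (hryadj m).1.1
    set S := symmHull {(rx (m + 0), ry (m + 0))} with hS
    set SY := symmHull (⋃ n, {(ry (m + n), ry (m + (n + 1)))}) with hSY
    set SX := symmHull (⋃ n, {(rx (m + n), rx (m + (n + 1)))}) with hSX
    have hSY' : ∀ p q, (p, q) ∈ SY → p ∉ X ∧ q ∉ X := by
      intro p q hpq
      simp only [hSY, symmHull_iUnion, Set.mem_iUnion, mem_symmHull_singleton,
        Prod.mk.injEq] at hpq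
      obtain ⟨n, ⟨rfl, rfl⟩ | ⟨rfl, rfl⟩⟩ := hpq
      · exact (hryadj _).1
      · exact (hryadj _).1.symm
    have hSX' : ∀ p q, (p, q) ∈ SX → p ∈ X ∧ q ∈ X := by
      intro p q hpq
      simp only [hSX, symmHull_iUnion, Set.mem_iUnion, mem_symmHull_singleton,
        Prod.mk.injEq] at hpq
      obtain ⟨n, ⟨rfl, rfl⟩ | ⟨rfl, rfl⟩⟩ := hpq
      · exact (hrxadj _).1
      · exact (hrxadj _).1.symm
    have hS' : ∀ p q, (p, q) ∈ S → (p = rx m ∧ q = ry m) ∨ (p = ry m ∧ q = rx m) := by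
      intro p q hpq
      simpa [hS, mem_symmHull_singleton] using hpq
    have hN : IsSymmSet (S ∪ (SY ∪ SX)) := by
      rw [hS, hSY, hSX, ← symmHull_union, ← symmHull_union]
      exact isSymmSet_symmHull _
    have hsub : (D.flip (S ∪ (SY ∪ SX))).outArcs X ⊂ D.outArcs X := by
      refine ⟨?_, fun h' => ?_⟩
      · rintro ⟨p, q⟩ ⟨hp, hq, ⟨hpq | hpq | hpq, hadj⟩ | ⟨-, hadj⟩⟩
        · rcases hS' p q hpq with ⟨rfl, rfl⟩ | ⟨rfl, rfl⟩
          · exact absurd hadj (hD.asymm hm.2.2)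
          · exact absurd hp hym
        · exact absurd hp (hSY' p q hpq).1
        · exact absurd (hSX' p q hpq).2 hq
        · exact ⟨hp, hq, hadj⟩
      · have h1 := (h' hm).2.2
        have h2 : (rx m, ry m) ∈ S ∪ (SY ∪ SX) := Or.inl (Or.inl rfl)
        rw [flip_adj_of_mem h2] at h1
        exact hD.asymm hm.2.2 h1
    refine ih _ (Set.ncard_lt_ncard hsub hfin) (hD.flip hN) (X := X)
      ⟨?_, fun v hv => ?_, fun v hv => ?_⟩ rfl
    · exact lt_aleph0_iff_set_finite.2 (hfin.subset hsub.1)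
    · have hf : {z | (v, z) ∈ SY}.Finite :=
        finite_ray_neighbours (r := fun n => ry (m + n))
          (fun i j hij => Nat.add_left_cancel (hry hij)) v
      refine lt_aleph0_iff_set_finite.2 (((hout v hv).union hf).subset ?_)
      rintro z ⟨hz, ⟨hpq | hpq | hpq, hadj⟩ | ⟨-, hadj⟩⟩
      · rcases hS' v z hpq with ⟨rfl, rfl⟩ | ⟨rfl, rfl⟩
        · exact absurd hxm hv
        · exact absurd hxm hz
      · exact Or.inr hpq
      · exact absurd (hSX' v z hpq).1 hv
      · exact Or.inl ⟨hz, hadj⟩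
    · have hf : {z | (v, z) ∈ SX}.Finite :=
        finite_ray_neighbours (r := fun n => rx (m + n))
          (fun i j hij => Nat.add_left_cancel (hrx hij)) v
      refine lt_aleph0_iff_set_finite.2 (((hin v hv).union hf).subset ?_)
      rintro z ⟨hz, ⟨hpq | hpq | hpq, hadj⟩ | ⟨-, hadj⟩⟩
      · rcases hS' z v hpq with ⟨rfl, rfl⟩ | ⟨rfl, rfl⟩
        · exact absurd hv hym
        · exact absurd hz hym
      · exact absurd hz (hSY' z v hpq).1
      · exact Or.inr (isSymmSet_symmHull _ _ _ hpq)
      · exact Or.inl ⟨hz, hadj⟩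

/-! ### Breaking uncountable barriers -/

theorem mk_iUnion_le_of_le {ι α : Type u} {κ : Cardinal.{u}} (hκ : ℵ₀ ≤ κ) (hι : #ι ≤ κ)
    {s : ι → Set α} (h : ∀ i, #(s i) ≤ κ) : #(⋃ i, s i) ≤ κ := by
  refine (mk_iUnion_le_sum_mk.trans (sum_le_sum _ (fun _ => κ) h)).trans ?_
  rw [sum_const']
  exact mul_le_of_le hκ hι le_rfl

theorem mk_union_le_of_le {α : Type u} {κ : Cardinal.{u}} (hκ : ℵ₀ ≤ κ) {s t : Set α}
    (hs : #s ≤ κ) (ht : #t ≤ κ) : #(s ∪ t : Set α) ≤ κ :=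
  (mk_union_le s t).trans (add_le_of_le hκ hs ht)

theorem mk_pairs_le {κ : Cardinal.{u}} (hκ : ℵ₀ ≤ κ) {T : Set V} (hT : #T ≤ κ)
    {R : V → V → Prop} (h : ∀ y ∈ T, #{z | R y z} ≤ κ) :
    #{p : V × V | p.1 ∈ T ∧ R p.1 p.2} ≤ κ := by
  refine (mk_le_mk_of_subset ?_).trans (mk_iUnion_le_of_le hκ hT
    (s := fun y : T => Prod.mk y.1 '' {z | R y z}) fun y => mk_image_le.trans (h y y.2))
  rintro ⟨y, z⟩ ⟨hy, hz⟩
  exact Set.mem_iUnion.2 ⟨⟨y, hy⟩, z, hz, rfl⟩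

theorem mk_pairs_le' {κ : Cardinal.{u}} (hκ : ℵ₀ ≤ κ) {T : Set V} (hT : #T ≤ κ)
    {R : V → V → Prop} (h : ∀ y ∈ T, #{z | R z y} ≤ κ) :
    #{p : V × V | p.2 ∈ T ∧ R p.1 p.2} ≤ κ := by
  refine (mk_le_mk_of_subset ?_).trans
    ((mk_image_le (f := Prod.swap)).trans (mk_pairs_le hκ hT (R := fun y z => R z y) h))
  rintro ⟨y, z⟩ ⟨hy, hz⟩
  exact ⟨(z, y), ⟨hy, hz⟩, rfl⟩

/-- The set of vertices reachable from a small set through small out-neighbourhoods is small. -/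
theorem mk_reflTransGen_le {κ : Cardinal.{u}} (hκ : ℵ₀ ≤ κ) {S : Set V} (hS : #S ≤ κ)
    {R : V → V → Prop} (h : ∀ y, #{z | R y z} ≤ κ) :
    #{z | ∃ s ∈ S, Relation.ReflTransGen R s z} ≤ κ := by
  let F : Set V → Set V := fun T => ⋃ y : T, {z | R y z}
  let L : ℕ → Set V := fun n => F^[n] S
  have hsucc : ∀ n, L (n + 1) = ⋃ y : L n, {z | R y z} := fun n =>
    Function.iterate_succ_apply' F n S
  have hL : ∀ n : ℕ, #(L n : Set V) ≤ κ := by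
    intro n
    induction n with
    | zero => exact hS
    | succ n ih =>
      rw [hsucc]
      exact mk_iUnion_le_of_le hκ ih fun y => h y
  refine (mk_le_mk_of_subset ?_).trans (mk_iUnion_le_of_le (ι := ULift.{u} ℕ) hκ (by simpa)
    (s := fun n => L n.down) fun n => hL _)
  rintro z ⟨s, hs, hz⟩
  induction hz with
  | refl => exact Set.mem_iUnion.2 ⟨⟨0⟩, hs⟩
  | tail _ hyz ih =>
    obtain ⟨⟨n⟩, hn⟩ := Set.mem_iUnion.1 ih
    refine Set.mem_iUnion.2 ⟨⟨n + 1⟩, ?_⟩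
    rw [hsucc]
    exact Set.mem_iUnion.2 ⟨⟨_, hn⟩, hyz⟩

/-- If `T` were larger than `ν`, take a subset `W` of size `ν`. Some vertex of `T` lies outside `W`
and all out-neighbourhoods of `W`; it then dominates all of `W`, too many out-neighbours. -/
theorem mk_le_of_out_lt {D : Digraph V} (hD : D.IsTournament) {ν : Cardinal.{u}} (hν : ℵ₀ ≤ ν)
    {T : Set V} (h : ∀ y ∈ T, #{z | z ∈ T ∧ D.Adj y z} < ν) : #T ≤ ν := by
  by_contra! hT
  obtain ⟨W, hWT, hW⟩ := le_mk_iff_exists_subset.1 hT.le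
  have hU : #(W ∪ ⋃ w : W, {z | z ∈ T ∧ D.Adj w z} : Set V) ≤ ν :=
    mk_union_le_of_le hν hW.le (mk_iUnion_le_of_le hν hW.le fun w => (h w (hWT w.2)).le)
  obtain ⟨z, hz, hzU⟩ : ∃ z ∈ T, z ∉ (W ∪ ⋃ w : W, {z | z ∈ T ∧ D.Adj w z} : Set V) := by
    by_contra! hno
    exact ((mk_le_mk_of_subset hno).trans hU).not_gt hT
  refine ((mk_le_mk_of_subset ?_).trans_lt (h z hz)).ne hW
  intro w hw
  refine ⟨hWT hw, hD.adj_of_not ?_ fun hwz => hzU (Or.inr (Set.mem_iUnion.2 ⟨⟨w, hw⟩, hz, hwz⟩))⟩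
  rintro rfl
  exact hzU (Or.inl hw)

/-- Vertices of a strong component outside `X` are reached from few vertices without entering
`X`. -/
theorem mk_comp_sdiff_le {D D' : Digraph V} {X : Set V} {ν : Cardinal.{u}} (hν : ℵ₀ ≤ ν) {a : V}
    (hadj : ∀ x ∈ D'.comp a, ∀ y ∈ D'.comp a, D'.Adj x y → D.Adj x y)
    (hX : #(D.outArcs X) ≤ ν)
    (hout : ∀ y ∈ D'.comp a, y ∉ X → #{z | z ∉ X ∧ D.Adj y z} ≤ ν) :
    #(D'.comp a \ X : Set V) ≤ ν := by
  let R : V → V → Prop := fun y z => y ∈ D'.comp a ∧ y ∉ X ∧ z ∉ X ∧ D.Adj y z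
  -- A path ending outside `X` has a final stretch outside `X` that begins either at `a` or at the
  -- head of a cut arc.
  have hS : #(Prod.snd '' D.outArcs X ∪ {a} : Set V) ≤ ν :=
    mk_union_le_of_le hν (mk_image_le.trans hX) ((mk_singleton a).trans_le
      (one_lt_aleph0.le.trans hν))
  refine (mk_le_mk_of_subset ?_).trans (mk_reflTransGen_le hν hS (R := R) fun y => ?_)
  · rintro b ⟨hb, hbX⟩
    have hab := hb.reach_within
    clear hb
    induction hab with
    | refl => exact ⟨_, Or.inr rfl, .refl⟩
    | @tail c d _ hcd ih =>
      have hcd' := hadj _ hcd.1 _ hcd.2.1 hcd.2.2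
      by_cases hc : c ∈ X
      · exact ⟨d, Or.inl ⟨(c, d), ⟨hc, hbX, hcd'⟩, rfl⟩, .refl⟩
      · obtain ⟨s, hs, hsc⟩ := ih hc
        exact ⟨s, hs, hsc.tail ⟨hcd.1, hc, hbX, hcd'⟩⟩
  · by_cases hy : y ∈ D'.comp a ∧ y ∉ X
    · exact (mk_le_mk_of_subset fun z hz => hz.2.2).trans (hout y hy.1 hy.2)
    · have : {z | R y z} = ∅ := Set.eq_empty_of_forall_notMem fun z hz => hy ⟨hz.1, hz.2.1⟩
      rw [this, mk_eq_zero]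
      exact zero_le

theorem mk_outArcs_op (D : Digraph V) (X : Set V) : #(D.op.outArcs Xᶜ) ≤ #(D.outArcs X) := by
  refine (mk_le_mk_of_subset ?_).trans (mk_image_le (f := Prod.swap))
  rintro ⟨a, b⟩ ⟨ha, hb, hab⟩
  exact ⟨(b, a), ⟨not_not.1 hb, ha, hab⟩, rfl⟩

/-- The part inside `X` is bounded by applying the preceding bound to the complement of `X` in the
opposite digraph. -/
theorem mk_comp_le {D D' : Digraph V} {X : Set V} {ν : Cardinal.{u}} (hν : ℵ₀ ≤ ν) {a : V}
    (hadj : ∀ x ∈ D'.comp a, ∀ y ∈ D'.comp a, D'.Adj x y → D.Adj x y)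
    (hX : #(D.outArcs X) ≤ ν)
    (hout : ∀ y ∈ D'.comp a, y ∉ X → #{z | z ∉ X ∧ D.Adj y z} ≤ ν)
    (hin : ∀ x ∈ D'.comp a, x ∈ X → #{z | z ∈ X ∧ D.Adj z x} ≤ ν) :
    #(D'.comp a) ≤ ν := by
  have h1 := mk_comp_sdiff_le hν hadj hX hout
  have h2 : #(D'.op.comp a \ Xᶜ : Set V) ≤ ν := by
    refine mk_comp_sdiff_le (D := D.op) hν ?_ ((mk_outArcs_op D X).trans hX) ?_
    · rw [comp_op]
      exact fun x hx y hy h => hadj y hy x hx h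
    · rw [comp_op]
      intro x hx hxX
      simpa [op] using hin x hx (not_not.1 hxX)
  rw [comp_op] at h2
  refine (mk_le_mk_of_subset ?_).trans (mk_union_le_of_le hν h1 h2)
  intro b hb
  by_cases h : b ∈ X
  · exact Or.inr ⟨hb, fun h' => h' h⟩
  · exact Or.inl ⟨hb, h⟩

/-- Let `ρ` be the degree bounded by the barrier, raised to at least the size `μ` of the cut.
Suitable flips make `ρ` constant on every component and leave the arcs inside components as in `D`.
Then the component of `a` has at most `ρ a < κ` vertices by `mk_comp_le`. -/
theorem breakable_of_barrier_uncountable {D : Digraph V} (hD : D.IsTournament)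
    {κ : Cardinal.{u}} (hκ : ℵ₀ < κ) {X : Set V} (h : IsBarrier κ D X) : Breakable κ D := by
  classical
  let μ : Cardinal.{u} := max ℵ₀ #(D.outArcs X)
  let ρ : V → Cardinal.{u} := fun v =>
    max μ (if v ∈ X then #{z | z ∈ X ∧ D.Adj z v} else #{z | z ∉ X ∧ D.Adj v z})
  have hμ : ℵ₀ ≤ μ := le_max_left _ _
  have hXμ : #(D.outArcs X) ≤ μ := le_max_right _ _
  have hμρ : ∀ v, μ ≤ ρ v := fun v => le_max_left _ _
  have hμκ : μ < κ := max_lt hκ h.mk_outArcs_lt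
  have hin : ∀ v ∈ X, #{z | z ∈ X ∧ D.Adj z v} ≤ ρ v := fun v hv => by
    simp only [ρ, hv, if_true]
    exact le_max_right _ _
  have hout : ∀ v ∉ X, #{z | z ∉ X ∧ D.Adj v z} ≤ ρ v := fun v hv => by
    simp only [ρ, hv, if_false]
    exact le_max_right _ _
  have hin' : ∀ v ∈ X, ∀ ν, μ ≤ ν → ν < ρ v → ν < #{z | z ∈ X ∧ D.Adj z v} := by
    intro v hv ν hμν hν
    simp only [ρ, hv, if_true] at hν
    exact (lt_max_iff.1 hν).resolve_left hμν.not_gt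
  have hout' : ∀ v ∉ X, ∀ ν, μ ≤ ν → ν < ρ v → ν < #{z | z ∉ X ∧ D.Adj v z} := by
    intro v hv ν hμν hν
    simp only [ρ, hv, if_false] at hν
    exact (lt_max_iff.1 hν).resolve_left hμν.not_gt
  have hρκ : ∀ v, ρ v < κ := by
    intro v
    by_cases hv : v ∈ X <;> simp only [ρ, hv, if_true, if_false]
    · exact max_lt hμκ (h.mk_in_lt v hv)
    · exact max_lt hμκ (h.mk_out_lt v hv)
  -- Flipped are the arcs along which `ρ` rises outside `X` or falls inside `X`, and the cut arcs
  -- with an end of `ρ`-value above `μ`.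
  let E : Set (V × V) := {p | D.Adj p.1 p.2 ∧ ((p.1 ∉ X ∧ p.2 ∉ X ∧ ρ p.1 < ρ p.2) ∨
    (p.1 ∈ X ∧ p.2 ∈ X ∧ ρ p.2 < ρ p.1) ∨ (p.1 ∈ X ∧ p.2 ∉ X ∧ (μ < ρ p.1 ∨ μ < ρ p.2)))}
  -- The ends of an arc of `E` are linked backwards at level `Order.succ (d e)`: the larger degree
  -- supplies more than `d e` candidates for a middle vertex, and at most `d e` of them fail.
  let d : V × V → Cardinal.{u} := fun p =>
    if p.1 ∈ X ∧ p.2 ∉ X then μ else min (ρ p.1) (ρ p.2)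
  have hμd : ∀ p, μ ≤ d p := by
    intro p
    simp only [d]
    split_ifs
    exacts [le_rfl, le_min (hμρ _) (hμρ _)]
  have hT1 : ∀ ν, ℵ₀ ≤ ν → ∀ P : Cardinal.{u} → Prop, (∀ σ, P σ → σ < ν) →
      #{v | v ∉ X ∧ P (ρ v)} ≤ ν := by
    intro ν hν P hP
    refine mk_le_of_out_lt hD hν fun y hy => ?_
    exact (mk_le_mk_of_subset (t := {z | z ∉ X ∧ D.Adj y z}) fun z hz =>
      ⟨hz.1.1, hz.2⟩).trans_lt ((hout y hy.1).trans_lt (hP _ hy.2))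
  have hT2 : ∀ ν, ℵ₀ ≤ ν → ∀ P : Cardinal.{u} → Prop, (∀ σ, P σ → σ < ν) →
      #{v | v ∈ X ∧ P (ρ v)} ≤ ν := by
    intro ν hν P hP
    refine mk_le_of_out_lt hD.op hν fun y hy => ?_
    exact (mk_le_mk_of_subset (t := {z | z ∈ X ∧ D.Adj z y}) fun z hz =>
      ⟨hz.1.1, hz.2⟩).trans_lt ((hin y hy.1).trans_lt (hP _ hy.2))
  -- A non-cut arc of `E` has an end with `ρ`-value `d e`. By `mk_le_of_out_lt` at most `ν` vertices
  -- have a `ρ`-value below `ν`, each on at most `ν` relevant arcs; cut arcs number at most `μ`.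
  have hcount : ∀ ν, μ ≤ ν → ∀ P : Cardinal.{u} → Prop, (∀ σ, P σ → σ < ν) →
      #{e : E // P (d e)} ≤ ν := by
    intro ν hν P hP
    have hν' := hμ.trans hν
    have h1 : #{p : V × V | p.1 ∈ {v | v ∉ X ∧ P (ρ v)} ∧ p.2 ∉ X ∧ D.Adj p.1 p.2} ≤ ν :=
      mk_pairs_le hν' (hT1 ν hν' P hP) (R := fun y z => z ∉ X ∧ D.Adj y z) fun y hy =>
        (hout y hy.1).trans (hP _ hy.2).le
    have h2 : #{p : V × V | p.2 ∈ {v | v ∈ X ∧ P (ρ v)} ∧ p.1 ∈ X ∧ D.Adj p.1 p.2} ≤ ν :=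
      mk_pairs_le' hν' (hT2 ν hν' P hP) (R := fun y z => y ∈ X ∧ D.Adj y z) fun y hy =>
        (hin y hy.1).trans (hP _ hy.2).le
    have h3 := mk_union_le_of_le hν' (mk_union_le_of_le hν' h1 h2) (hXμ.trans hν)
    change #{e : E | P (d e)} ≤ ν
    rw [← mk_image_eq (s := {e : E | P (d e)}) Subtype.val_injective]
    refine (mk_le_mk_of_subset ?_).trans h3
    rintro _ ⟨⟨p, hp, h4 | h4 | h4⟩, hP', rfl⟩
    · refine Or.inl (Or.inl ⟨⟨h4.1, ?_⟩, h4.2.1, hp⟩)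
      simpa [d, h4.1, min_eq_left h4.2.2.le] using hP'
    · refine Or.inl (Or.inr ⟨⟨h4.2.1, ?_⟩, h4.1, hp⟩)
      simpa [d, h4.2.1, min_eq_right h4.2.2.le] using hP'
    · exact Or.inr ⟨h4.1, h4.2.1, hp⟩
  have hsucc : ∀ σ : Cardinal.{u}, ℵ₀ ≤ σ → ℵ₀ ≤ Order.succ σ :=
    fun σ hσ => hσ.trans (Order.le_succ σ)
  have hmany : ∀ (ν : Cardinal.{u}) (S S' : Set V), ℵ₀ ≤ ν → ν < #S → #S' ≤ ν →
      ¬ #(S \ S' : Set V) < Order.succ ν := by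
    intro ν S S' hν hS hS' hlt
    have : S ⊆ S \ S' ∪ S' := by
      rw [Set.sdiff_union_self]
      exact Set.subset_union_left
    exact ((mk_le_mk_of_subset this).trans
      (mk_union_le_of_le hν (Order.lt_succ_iff.1 hlt) hS')).not_gt hS
  have hrev : Reversible D (symmHull E) Set.univ := by
    refine reversible_flip hD (fun a b h => h.1) (c := fun e => Order.succ (d e))
      (fun e => hsucc _ (hμ.trans (hμd _))) (fun e => ?_) (fun e => ?_) fun e Z hZ => ?_
    · simp only [Order.succ_le_succ_iff]
      exact hcount _ ((hμd _).trans (Order.le_succ _)) (fun σ => σ ≤ d e)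
        fun σ hσ => Order.lt_succ_of_le hσ
    · simp only [Order.succ_lt_succ_iff]
      exact Order.lt_succ_of_le (hcount _ (hμd _) (fun σ => σ < d e) fun σ hσ => hσ)
    · refine Linked.reflTransGen ?_ hZ
      obtain ⟨⟨y, w⟩, hp, h4 | h4 | h4⟩ := e
      · simp only at h4 hp ⊢
        have hd : d (y, w) = ρ y := by simp [d, h4.1, min_eq_left h4.2.2.le]
        have hν := hμ.trans (hμρ y)
        rw [hd]
        refine linked_of_many (S := {z | z ∉ X ∧ D.Adj w z} \ ({z | z ∉ X ∧ D.Adj y z} ∪ {y}))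
          (hsucc _ hν) (hmany _ _ _ hν (hout' w h4.2.1 _ (hμρ y) h4.2.2)
          (mk_union_le_of_le hν (hout y h4.1) ((mk_singleton y).trans_le
            (one_lt_aleph0.le.trans hν)))) fun z hz => ⟨hz.1.2, ?_⟩
        exact hD.adj_of_not (fun h => hz.2 (Or.inr h.symm)) fun h => hz.2 (Or.inl ⟨hz.1.1, h⟩)
      · simp only at h4 hp ⊢
        have hd : d (y, w) = ρ w := by simp [d, h4.2.1, min_eq_right h4.2.2.le]
        have hν := hμ.trans (hμρ w)
        rw [hd]
        refine linked_of_many (S := {z | z ∈ X ∧ D.Adj z y} \ ({z | z ∈ X ∧ D.Adj z w} ∪ {w}))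
          (hsucc _ hν) (hmany _ _ _ hν (hin' y h4.1 _ (hμρ w) h4.2.2)
          (mk_union_le_of_le hν (hin w h4.2.1) ((mk_singleton w).trans_le
            (one_lt_aleph0.le.trans hν)))) fun z hz => ⟨?_, hz.1.2⟩
        exact hD.adj_of_not (fun h => hz.2 (Or.inr h)) fun h => hz.2 (Or.inl ⟨hz.1.1, h⟩)
      · simp only at h4 hp ⊢
        have hd : d (y, w) = μ := by simp [d, h4.1, h4.2.1]
        rw [hd]
        rcases h4.2.2 with h5 | h5
        · refine linked_of_many (S := {z | z ∈ X ∧ D.Adj z y} \ {z | (z, w) ∈ D.outArcs X})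
            (hsucc _ hμ) (hmany _ _ _ hμ (hin' y h4.1 _ le_rfl h5)
            ((mk_preimage_of_injective (fun z => (z, w)) _
              fun _ _ h => (Prod.ext_iff.1 h).1).trans hXμ)) fun z hz => ⟨?_, hz.1.2⟩
          refine hD.adj_of_not ?_ fun h => hz.2 ⟨hz.1.1, h4.2.1, h⟩
          rintro rfl
          exact h4.2.1 hz.1.1
        · refine linked_of_many (S := {z | z ∉ X ∧ D.Adj w z} \ {z | (y, z) ∈ D.outArcs X})
            (hsucc _ hμ) (hmany _ _ _ hμ (hout' w h4.2.1 _ le_rfl h5)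
            ((mk_preimage_of_injective (Prod.mk y) _
              fun _ _ h => (Prod.ext_iff.1 h).2).trans hXμ)) fun z hz => ⟨hz.1.2, ?_⟩
          refine hD.adj_of_not ?_ fun h => hz.2 ⟨h4.1, hz.1.1, h⟩
          rintro rfl
          exact hz.1.1 h4.1
  refine Breakable.of_reversible hrev (breakable_of_comp_lt fun a => ?_)
  obtain ⟨D₁, hD₁⟩ : ∃ D₁, D₁ = D.flip (symmHull E) := ⟨_, rfl⟩
  rw [← hD₁]
  have hadj : ∀ a b, D₁.Adj a b → (D.Adj b a ∧ (b, a) ∈ E) ∨ (D.Adj a b ∧ (a, b) ∉ E) := by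
    intro a b h
    rw [hD₁] at h
    rcases h with ⟨h1 | h1, h2⟩ | ⟨h1, h2⟩
    · exact absurd h1.1 (hD.asymm h2)
    · exact Or.inl ⟨h2, h1⟩
    · exact Or.inr ⟨h2, fun h => h1 (Or.inl h)⟩
  -- Above `μ`, nothing in `X` reaches the outside, and `ρ` never rises along arcs outside `X`; `A2`
  -- is the dual statement for `X`.
  have A1 : ∀ x y, D₁.Reach x y → y ∉ X → μ < ρ y → x ∉ X ∧ ρ y ≤ ρ x := by
    intro x y hxy hy hμy
    induction hxy using Relation.ReflTransGen.head_induction_on with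
    | refl => exact ⟨hy, le_rfl⟩
    | @head x c h _ ih =>
      obtain ⟨hc, hle⟩ := ih
      have hμc := hμy.trans_le hle
      rcases hadj _ _ h with ⟨-, -, h1 | h1 | h1⟩ | ⟨h1, h2⟩
      · exact ⟨h1.2.1, hle.trans h1.2.2.le⟩
      · exact absurd h1.1 hc
      · exact absurd h1.1 hc
      · by_cases hx : x ∈ X
        · exact absurd ⟨h1, Or.inr (Or.inr ⟨hx, hc, Or.inr hμc⟩)⟩ h2
        · exact ⟨hx, hle.trans (not_lt.1 fun h3 => h2 ⟨h1, Or.inl ⟨hx, hc, h3⟩⟩)⟩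
  have A2 : ∀ x y, D₁.Reach x y → x ∈ X → μ < ρ x → y ∈ X ∧ ρ x ≤ ρ y := by
    intro x y hxy hx hμx
    induction hxy with
    | refl => exact ⟨hx, le_rfl⟩
    | @tail c y _ h ih =>
      obtain ⟨hc, hle⟩ := ih
      have hμc := hμx.trans_le hle
      rcases hadj _ _ h with ⟨-, -, h1 | h1 | h1⟩ | ⟨h1, h2⟩
      · exact absurd hc h1.2.1
      · exact ⟨h1.1, hle.trans h1.2.2.le⟩
      · exact absurd hc h1.2.1
      · by_cases hy : y ∈ X
        · exact ⟨hy, hle.trans (not_lt.1 fun h3 => h2 ⟨h1, Or.inr (Or.inl ⟨hc, hy, h3⟩)⟩)⟩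
        · exact absurd ⟨h1, Or.inr (Or.inr ⟨hc, hy, Or.inl hμc⟩)⟩ h2
  have A3 : ∀ x y, D₁.Conn x y → μ < ρ x → ρ x ≤ ρ y ∧ (x ∈ X ↔ y ∈ X) := by
    intro x y hxy hμx
    by_cases hx : x ∈ X
    · obtain ⟨h1, h2⟩ := A2 x y hxy.1 hx hμx
      exact ⟨h2, iff_of_true hx h1⟩
    · obtain ⟨h1, h2⟩ := A1 y x hxy.2 hx hμx
      exact ⟨h2, iff_of_false hx h1⟩
  have A4 : ∀ x y, D₁.Conn x y → ρ x ≤ ρ y := fun x y hxy =>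
    (hμρ x).eq_or_lt.elim (fun h => h ▸ hμρ y) fun h => (A3 x y hxy h).1
  have A5 : ∀ x ∈ D₁.comp a, ρ x ≤ ρ a := fun x hx => A4 x a hx.symm
  refine (mk_comp_le (D := D) (X := X) (hμ.trans (hμρ a)) ?_ (hXμ.trans (hμρ a))
    (fun y hy hyX => (hout y hyX).trans (A5 y hy))
    fun x hx hxX => (hin x hxX).trans (A5 x hx)).trans_lt (hρκ a)
  intro x hx y hy hxy
  have hc : D₁.Conn x y := hx.symm.trans hy
  have heq : ρ x = ρ y := le_antisymm (A4 x y hc) (A4 y x hc.symm)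
  rcases hadj x y hxy with ⟨-, -, h1 | h1 | h1⟩ | h1
  · exact absurd heq h1.2.2.ne'
  · exact absurd heq h1.2.2.ne
  · have hμx : μ < ρ x := by
      rcases h1.2.2 with h2 | h2
      · exact h2.trans_eq heq.symm
      · exact h2
    exact absurd ((A3 x y hc hμx).2.2 h1.1) h1.2.1
  · exact h1.1

/-! ### Induction on the number of vertices -/

/-- Every tournament has a locally finite reversal sequence after which all strong components
are finite. -/
theorem IsTournament.breakable {D : Digraph V} (hD : D.IsTournament) : Breakable ℵ₀ D := by
  induction hκ : #V using WellFoundedLT.induction generalizing V with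
  | ind κ ih =>
    rcases lt_or_ge κ ℵ₀ with hlt | hge
    · exact breakable_of_comp_lt fun a => (mk_set_le _).trans_lt (hκ.trans_lt hlt)
    have hcount : ∀ (W : Type u) (D' : Digraph W) (X : Set W), #W ≤ ℵ₀ → D'.IsTournament →
        IsBarrier ℵ₀ D' X → Breakable ℵ₀ D' := by
      intro W D' X hW hD' h
      have : Countable W := mk_le_aleph0_iff.1 hW
      exact breakable_of_barrier_countable hD' h
    rcases hge.eq_or_lt with rfl | hgt
    · exact breakable_of_barrier hD le_rfl hκ.le hcount
    · obtain ⟨N, hN, hlt⟩ := breakable_of_barrier hD hge hκ.le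
        fun W D' X _ hD' h => breakable_of_barrier_uncountable hD' hgt h
      refine Breakable.of_reversible hN (Breakable.of_comp fun a => ?_)
      exact ih _ (hlt a) ((hD.flip hN.isSymmSet).induced _) rfl

end Digraph

theorem mainTheorem1 {V : Type u} (D : Digraph V) (hD : D.IsTournament) :
    ∃ (α : Ordinal.{u}) (C : Ordinal.{u} → Set (V × V)) (D' : Digraph V),
      Digraph.LocallyFiniteBelow C α ∧ D.ReversesTo C α D' ∧
        ∀ S : Set V, D'.IsStrongComponent S → S.Finite :=
  hD.breakable.exists_reversesTo hD
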